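/- Let $V$ be a complex vector space of finite dimension $n$ with a nondegenerate hermitian form $h:V\times V\to\mathbb C$ (of any signature; $h$ is linear in the first variable and $h(v,w)=\overline{h(w,v)}$). Put $\langle v,w\rangle=\operatorname{Re}h(v,w)$, let $J:V\to V$ be multiplication by $i$, and let $\det_{\mathbb C}(w_1,\dots,w_n)$ be the determinant of the coordinates of $w_1,\dots,w_n\in V$ in a fixed, arbitrary $\mathbb C$-basis of $V$. Let $SU(V,h)$ be the group of all $g\in GL_{\mathbb C}(V)$ with $\det g=1$ and $h(gv,gw)=h(v,w)$ for all $v,w\in V$, and let $r\ge 0$ be an integer. Then the functions $f:V^r\to\mathbb R$ that are $\mathbb R$-multilinear and $SU(V,h)$-invariant, i.e. $f(gv_1,\dots,gv_r)=f(v_1,\dots,v_r)$ for all $g\in SU(V,h)$ and $v_1,\dots,v_r\in V$, are exactly the real linear combinations of the real parts and the imaginary parts of the maps $$(v_1,\dots,v_r)\longmapsto\Bigl(\prod_{j=1}^m\bigl\langle v_{\sigma(2j-1)},J^{\delta_j}v_{\sigma(2j)}\bigr\rangle\Bigr)\Bigl(\prod_{l=0}^{s-1}\det{}_{\mathbb C}\bigl(v_{\sigma(2m+nl+1)},\dots,v_{\sigma(2m+n(l+1))}\bigr)\Bigr),$$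 where $m,s\ge 0$ are integers with $r=2m+ns$, $\sigma\in S_r$, and $\delta_1,\dots,\delta_m\in\{0,1\}$. -/

import Mathlib

namespace UnitaryInvariants

variable {V : Type*} [AddCommGroup V] [Module ℂ V]

/-- A sesquilinear form `h`, linear in the first and conjugate-linear in the second variable, is
hermitian if `h(v,w)` is the complex conjugate of `h(w,v)`. -/
def IsHermitianForm (h : V →ₗ[ℂ] V →ₗ⋆[ℂ] ℂ) : Prop :=
  ∀ v w : V, h v w = (starRingEnd ℂ) (h w v)

/-- The unitary group `U(V,h)` inside `GL(V)`. -/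
def unitaryGroup (h : V →ₗ[ℂ] V →ₗ⋆[ℂ] ℂ) : Subgroup (V ≃ₗ[ℂ] V) where
  carrier := {g | ∀ v w : V, h (g v) (g w) = h v w}
  one_mem' := fun _ _ => rfl
  mul_mem' := by
    intro a b ha hb v w
    exact (ha (b v) (b w)).trans (hb v w)
  inv_mem' := by
    intro a ha v w
    have key := ha (a.symm v) (a.symm w)
    rw [a.apply_symm_apply, a.apply_symm_apply] at key
    exact key.symm

/-- The special unitary group `SU(V,h)`: the elements of `U(V,h)` of complex determinant `1`. -/
noncomputable def specialUnitaryGroup (h : V →ₗ[ℂ] V →ₗ⋆[ℂ] ℂ) : Subgroup (V ≃ₗ[ℂ] V) :=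
  unitaryGroup h ⊓ (LinearEquiv.det : (V ≃ₗ[ℂ] V) →* ℂˣ).ker

/-- `F : V × ⋯ × V → ℝ` is an `ℝ`-multilinear form (for the real structure underlying the complex
vector space `V`) which is invariant under `SU(V,h)`. -/
def IsInvariantForm (h : V →ₗ[ℂ] V →ₗ⋆[ℂ] ℂ) {r : ℕ} (F : (Fin r → V) → ℝ) : Prop :=
  (∃ f : MultilinearMap ℝ (fun _ : Fin r => V) ℝ, ∀ v, f v = F v) ∧
    ∀ g ∈ specialUnitaryGroup h, ∀ v : Fin r → V, F (fun i => g (v i)) = F v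

/-- The pairing `⟨v, w⟩`, the real part of `h(v,w)`. -/
def pairing (h : V →ₗ[ℂ] V →ₗ⋆[ℂ] ℂ) (v w : V) : ℝ := (h v w).re

theorem block_lt {n m s r : ℕ} (hr : r = 2 * m + n * s) (l : Fin s) (k : Fin n) :
    2 * m + n * (l : ℕ) + (k : ℕ) < r := by
  have h1 : n * ((l : ℕ) + 1) ≤ n * s := Nat.mul_le_mul_left n l.isLt
  have h2 := k.isLt
  rw [Nat.mul_add, Nat.mul_one] at h1
  omega

/-- For `r = 2m + ns`, a permutation `σ` and exponents `δ`, the complex-valued map sending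
`(v₁, …, v_r)` to the product of the `m` pairings `⟨v_{σ(2j-1)}, J^{δ_j} v_{σ(2j)}⟩`, where `J` is
multiplication by `i`, and of the `s` determinants of the blocks of length `n` which make up
`v_{σ(2m+1)}, …, v_{σ(r)}`. Indices start at `0` here, and determinants are taken in the
coordinates of the basis `b`. -/
noncomputable def basicInvariant {n : ℕ} (h : V →ₗ[ℂ] V →ₗ⋆[ℂ] ℂ) (b : Module.Basis (Fin n) ℂ V)
    {m s r : ℕ} (hr : r = 2 * m + n * s) (σ : Equiv.Perm (Fin r)) (δ : Fin m → Fin 2)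
    (v : Fin r → V) : ℂ :=
  (∏ j : Fin m, (pairing h (v (σ ⟨2 * (j : ℕ), by omega⟩))
      (Complex.I ^ (δ j : ℕ) • v (σ ⟨2 * (j : ℕ) + 1, by omega⟩)) : ℂ)) *
    ∏ l : Fin s, b.det (fun k : Fin n => v (σ ⟨2 * m + n * (l : ℕ) + (k : ℕ), block_lt hr l k⟩))

/-- The real and the imaginary parts of all the maps `basicInvariant`. -/
def basicRealForms {n : ℕ} (h : V →ₗ[ℂ] V →ₗ⋆[ℂ] ℂ) (b : Module.Basis (Fin n) ℂ V) (r : ℕ) :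
    Set ((Fin r → V) → ℝ) :=
  {F | ∃ (m s : ℕ) (hr : r = 2 * m + n * s) (σ : Equiv.Perm (Fin r)) (δ : Fin m → Fin 2),
    (F = fun v => (basicInvariant h b hr σ δ v).re) ∨
      (F = fun v => (basicInvariant h b hr σ δ v).im)}

end UnitaryInvariants

/-!
Write `V` for the complex vector space. Splitting a real multilinear map on `V` into parts that are
linear or conjugate-linear in each argument, and identifying conjugate-linear functions of `w` with
linear functions of the covector `h(·, w)`, an invariant becomes a complex multilinear function
`G(v, ξ)` of vectors `v` and covectors `ξ`, with `G(gv, ξ) = G(v, ξ ∘ g)` for `g` in `SU(V, h)`.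
Up to complex conjugation there are at least as many vectors as covectors.

*From `SU` to all endomorphisms.* The scalar `n`-th roots of unity force the numbers of vectors and
of covectors to differ by a multiple `nt` of `n`; since `U(V, h)` is `SU(V, h)` times scalars,
`G(gv, ξ) = (det g)ᵗ G(v, ξ ∘ g)` for unitary `g`. The Cayley transform parametrizes unitary maps by
skew-adjoint ones, and these are a real form of `End(V)`, so this polynomial identity in `g` holds
on all of `End(V)` (`mem_covariants_of_unitaryGroup`).

*The first fundamental theorem.* Both sides of the identity are homogeneous in `g`, so they can be
polarized (`sum_perm_eq_sum_perm`) and evaluated at rank one endomorphisms `ηᵢ ⊗ uᵢ`. The right side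
becomes a combination of products of pairings `ξⱼ(u)` and determinants of vectors `u`, while the
left side is a weighted sum of `G(u ∘ ω, ξ)` over permutations `ω` (`sum_perm_covariant`). Taking
`η` and `v` from dual bases and summing, the left side is the image of `G` under `∑ ω, tr(ω) ω`,
where `tr(ω)` is the trace of `ω` on a tensor power of `V`. That operator is positive definite
(`eq_zero_of_sum_fixed_eq_zero`), hence bijective on the finite-dimensional space of all `G`
satisfying the identity. So each such `G` is a combination of products of pairings and determinants
(`covariant_mem_span`).

Substituting `ξ = h(·, w)` and `h(v, w) = ⟨v, w⟩ + i⟨v, Jw⟩` gives the maps `basicInvariant`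
(`prod_hermitian_mul_prod_det_mem_complexSpan`).
-/

namespace UnitaryInvariants

open Module

/-! ### Polarization -/

section Polarization

variable {ι E M : Type*} [Fintype ι] [DecidableEq ι] [AddCommGroup E] [Module ℂ E]
  [AddCommGroup M] [Module ℂ M]

theorem sum_neg_one_pow_card_of_not_surjective {φ : ι → ι} (hφ : ¬ Function.Surjective φ) :
    ∑ S : Finset ι, (if ∀ i, φ i ∈ S then (-1 : ℂ) ^ S.card else 0) = 0 := by
  simp only [Function.Surjective, not_forall, not_exists] at hφ
  obtain ⟨i₀, hi₀⟩ := hφ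
  -- Adding or removing an element outside the range of `φ` pairs up the terms with opposite signs.
  refine Finset.sum_involution (fun S _ => symmDiff S {i₀}) ?_ ?_ (fun _ _ => Finset.mem_univ _) ?_
  · intro S _
    have h1 : (∀ i, φ i ∈ symmDiff S {i₀}) ↔ ∀ i, φ i ∈ S := by
      refine forall_congr' fun i => ?_
      simp [Finset.mem_symmDiff, hi₀ i]
    simp only [h1]
    split_ifs
    · by_cases h : i₀ ∈ S
      · have : symmDiff S {i₀} = S.erase i₀ := by
          ext j; simp only [Finset.mem_symmDiff, Finset.mem_singleton, Finset.mem_erase]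
          constructor
          · rintro (h' | ⟨rfl, h'⟩)
            · exact ⟨h'.2, h'.1⟩
            · exact absurd h h'
          · exact fun h' => Or.inl ⟨h'.2, h'.1⟩
        rw [this, ← Finset.card_erase_add_one h, pow_succ]; ring
      · have : symmDiff S {i₀} = insert i₀ S := by
          ext j; simp only [Finset.mem_symmDiff, Finset.mem_singleton, Finset.mem_insert]
          constructor
          · rintro (h' | h')
            · exact Or.inr h'.1
            · exact Or.inl h'.1
          · rintro (rfl | h')
            · exact Or.inr ⟨rfl, h⟩
            · exact Or.inl ⟨h', fun e => h (e ▸ h')⟩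
        rw [this, Finset.card_insert_of_notMem h, pow_succ]; ring
    · simp
  · intro S _ _ h
    have : i₀ ∈ symmDiff S {i₀} ↔ i₀ ∈ S := by rw [h]
    simp only [Finset.mem_symmDiff, Finset.mem_singleton] at this
    tauto
  · intro S _
    simp

/-- A multilinear map vanishing on the diagonal has zero symmetrization, by inclusion–exclusion over
its values at the partial sums of the family `g`. -/
theorem sum_perm_eq_zero (L : MultilinearMap ℂ (fun _ : ι => E) M) (hL : ∀ g, L (fun _ => g) = 0)
    (g : ι → E) : ∑ ω : Equiv.Perm ι, L (fun i => g (ω i)) = 0 := by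
  have key : ∑ φ : ι → ι, (∑ S : Finset ι, (if ∀ i, φ i ∈ S then (-1 : ℂ) ^ S.card else 0)) •
      L (fun i => g (φ i)) = 0 := by
    simp_rw [Finset.sum_smul]
    rw [Finset.sum_comm]
    refine Finset.sum_eq_zero fun S _ => ?_
    have h1 := hL (∑ i ∈ S, g i)
    rw [L.map_sum_finset (fun _ => g) (fun _ => S)] at h1
    simp_rw [ite_smul, zero_smul]
    rw [← Finset.sum_filter, ← Finset.smul_sum]
    convert smul_zero _
    rw [← h1]
    refine Finset.sum_congr ?_ fun _ _ => rfl
    ext φ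
    simp
  rw [← Finset.sum_filter_add_sum_filter_not _ (fun φ : ι → ι => Function.Bijective φ),
    Finset.sum_eq_zero (s := Finset.univ.filter fun φ : ι → ι => ¬ Function.Bijective φ),
    add_zero] at key
  · have h2 : ∑ φ : ι → ι with Function.Bijective φ, (-1 : ℂ) ^ Fintype.card ι •
        L (fun i => g (φ i)) = 0 := by
      rw [← key]
      refine Finset.sum_congr rfl fun φ hφ => ?_
      have hφ' := (Finset.mem_filter.1 hφ).2
      congr 1
      rw [Finset.sum_eq_single Finset.univ]
      · simp
      · intro S _ hS
        rw [if_neg]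
        intro h
        refine hS (Finset.eq_univ_of_forall fun j => ?_)
        obtain ⟨i, rfl⟩ := hφ'.2 j
        exact h i
      · simp
    rw [← Finset.smul_sum, smul_eq_zero_iff_right (by simp)] at h2
    rw [← h2]
    refine Finset.sum_bij' (fun ω _ => (ω : ι → ι))
      (fun φ hφ => Equiv.ofBijective φ (Finset.mem_filter.1 hφ).2) ?_ ?_ ?_ ?_ ?_
    · intro ω _; simp
    · simp
    · intro ω _; ext; simp
    · intro φ _; rfl
    · intro ω _; rfl
  · intro φ hφ
    have hφ' := (Finset.mem_filter.1 hφ).2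
    rw [sum_neg_one_pow_card_of_not_surjective, zero_smul]
    intro h
    exact hφ' (Finite.surjective_iff_bijective.1 h)

theorem sum_perm_eq_sum_perm {L L' : MultilinearMap ℂ (fun _ : ι => E) M}
    (hL : ∀ g, L (fun _ => g) = L' (fun _ => g)) (g : ι → E) :
    ∑ ω : Equiv.Perm ι, L (fun i => g (ω i)) = ∑ ω : Equiv.Perm ι, L' (fun i => g (ω i)) := by
  have := sum_perm_eq_zero (L - L') (fun g => by simp [hL g]) g
  simpa [sub_eq_zero, Finset.sum_sub_distrib] using this

end Polarization

/-! ### A positive definite operator on tensors -/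

section Positivity

variable {ι α : Type*} [Fintype ι] [DecidableEq ι] [Fintype α] [DecidableEq α]

/-- The operator `∑ ω, tr(ω) ω` on tensors of shape `ι`, where `tr(ω)` counts the index tuples
fixed by `ω`, is positive definite, hence injective. -/
theorem eq_zero_of_sum_fixed_eq_zero (x : (ι → α) → ℂ)
    (hx : ∀ c : ι → α, ∑ a : ι → α, ∑ ω : Equiv.Perm ι, (if a ∘ ω = a then x (c ∘ ω) else 0) = 0)
    (c : ι → α) : x c = 0 := by
  classical
  let y : (ι → α) → (ι → α) → (ι → α) → ℂ := fun a a' c =>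
    ∑ ω : Equiv.Perm ι, if a ∘ ω = a' then x (c ∘ ω) else 0
  -- Averaging the quadratic form of the operator at `x` over all permutations `τ` shows that it is
  -- a positive multiple of the sum of the `|y a a' c|²`.
  have hy0 : ∑ a : ι → α, ∑ a' : ι → α, ∑ c : ι → α, y a a' c * (starRingEnd ℂ) (y a a' c) = 0 := by
    have e1 : ∀ a c, ∑ a', y a a' c * (starRingEnd ℂ) (y a a' c) =
        ∑ τ : Equiv.Perm ι, ∑ ω : Equiv.Perm ι,
          (if a ∘ ω = a ∘ τ then x (c ∘ ω) else 0) * (starRingEnd ℂ) (x (c ∘ τ)) := by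
      intro a c
      simp only [y, map_sum, Finset.mul_sum, Finset.sum_mul, apply_ite (starRingEnd ℂ), map_zero]
      rw [Finset.sum_comm]
      refine Finset.sum_congr rfl fun τ _ => ?_
      rw [Finset.sum_comm]
      refine Finset.sum_congr rfl fun ω _ => ?_
      simp only [mul_ite, mul_zero]
      rw [Finset.sum_ite_eq]
      simp
    have e2 : ∑ a : ι → α, ∑ a' : ι → α, ∑ c : ι → α, y a a' c * (starRingEnd ℂ) (y a a' c) =
        ∑ τ : Equiv.Perm ι, ∑ a : ι → α, ∑ c : ι → α, ∑ ω : Equiv.Perm ι,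
          (if a ∘ ω = a ∘ τ then x (c ∘ ω) else 0) * (starRingEnd ℂ) (x (c ∘ τ)) := by
      rw [Finset.sum_comm (s := (Finset.univ : Finset (Equiv.Perm ι)))]
      refine Finset.sum_congr rfl fun a _ => ?_
      rw [Finset.sum_comm, Finset.sum_comm (s := (Finset.univ : Finset (Equiv.Perm ι)))]
      exact Finset.sum_congr rfl fun c _ => e1 a c
    rw [e2]
    refine Finset.sum_eq_zero fun τ _ => ?_
    -- Substitute `a ∘ τ⁻¹`, `c ∘ τ⁻¹` and `τ * ω` for `a`, `c` and `ω`.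
    rw [← (Equiv.arrowCongr τ (Equiv.refl α)).sum_comp]
    rw [Finset.sum_comm, ← (Equiv.arrowCongr τ (Equiv.refl α)).sum_comp]
    refine Finset.sum_eq_zero fun c _ => ?_
    have h0 := congrArg (fun z => z * (starRingEnd ℂ) (x c)) (hx c)
    simp only [zero_mul, Finset.sum_mul] at h0
    refine Eq.trans ?_ h0
    refine Finset.sum_congr rfl fun a _ => ?_
    rw [← Equiv.sum_comp (Equiv.mulLeft τ)]
    refine Finset.sum_congr rfl fun ω _ => ?_
    have h3 : ∀ (d : ι → α) (ρ : Equiv.Perm ι),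
        (Equiv.arrowCongr τ (Equiv.refl α)) d ∘ (Equiv.mulLeft τ ρ) = d ∘ ρ := by
      intro d ρ; ext i; simp [Equiv.arrowCongr]
    have h4 : ∀ (d : ι → α), (Equiv.arrowCongr τ (Equiv.refl α)) d ∘ τ = d := by
      intro d; ext i; simp [Equiv.arrowCongr]
    rw [h3, h3, h4, h4]
  have hy : ∀ a a' c, y a a' c = 0 := by
    simp only [Complex.mul_conj] at hy0
    norm_cast at hy0
    intro a a' c
    have hn : ∀ z : ℂ, 0 ≤ Complex.normSq z := Complex.normSq_nonneg
    rw [Finset.sum_eq_zero_iff_of_nonneg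
      (fun _ _ => Finset.sum_nonneg fun _ _ => Finset.sum_nonneg fun _ _ => hn _)] at hy0
    have h1 := hy0 a (Finset.mem_univ _)
    rw [Finset.sum_eq_zero_iff_of_nonneg (fun _ _ => Finset.sum_nonneg fun _ _ => hn _)] at h1
    have h2 := h1 a' (Finset.mem_univ _)
    rw [Finset.sum_eq_zero_iff_of_nonneg (fun _ _ => hn _)] at h2
    exact Complex.normSq_eq_zero.1 (h2 c (Finset.mem_univ _))
  -- Contract `y c a' c` with the conjugate of `x a'` to get a sum of squares of entries of `x`.
  have h5 : ∑ ω : Equiv.Perm ι, x (c ∘ ω) * (starRingEnd ℂ) (x (c ∘ ω)) = 0 := by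
    have : ∑ a', (starRingEnd ℂ) (x a') * y c a' c = 0 := by simp [hy]
    rw [← this]
    simp only [y, Finset.mul_sum]
    rw [Finset.sum_comm]
    refine Finset.sum_congr rfl fun ω _ => ?_
    simp [mul_comm]
  simp only [Complex.mul_conj] at h5
  norm_cast at h5
  rw [Finset.sum_eq_zero_iff_of_nonneg (fun _ _ => Complex.normSq_nonneg _)] at h5
  simpa using h5 1 (Finset.mem_univ _)

end Positivity

/-! ### Covariant multilinear functions of vectors and covectors -/

section Covariant

variable {V : Type*} [AddCommGroup V] [Module ℂ V]

/-- The complex multilinear functions of vectors indexed by `ι` and covectors indexed by `κ`,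
in curried form. -/
abbrev MixedForm (ι κ V : Type*) [AddCommGroup V] [Module ℂ V] : Type _ :=
  MultilinearMap ℂ (fun _ : ι => V) (MultilinearMap ℂ (fun _ : κ => Dual ℂ V) ℂ)

/-- The mixed forms `G` with `G(gv, ξ) = (det g)ᵗ G(v, ξ ∘ g)` for all endomorphisms `g`, invertible
or not. For invertible `g` this says that `G` is a relative invariant of weight `t` of `GL(V)`. -/
def covariants (ι κ V : Type*) [AddCommGroup V] [Module ℂ V] (t : ℕ) :
    Submodule ℂ (MixedForm ι κ V) where
  carrier := {G | ∀ (g : V →ₗ[ℂ] V) (v : ι → V) (ξ : κ → Dual ℂ V),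
    G (fun i => g (v i)) ξ = LinearMap.det g ^ t * G v (fun j => ξ j ∘ₗ g)}
  add_mem' := by
    intro G G' h h' g v ξ
    simp [h g v ξ, h' g v ξ, mul_add]
  zero_mem' := by intro g v ξ; simp
  smul_mem' := by
    intro c G h g v ξ
    simp only [smul_apply, h g v ξ, smul_eq_mul]
    ring

variable {ι κ : Type*} {n t : ℕ}

/-- The operator `∑ ω, tr(ω) ω`, summed over the permutations of the vectors, on mixed forms. -/
noncomputable def traceOperator (ι κ V : Type*) [AddCommGroup V] [Module ℂ V] [Fintype ι]
    [DecidableEq ι] (n : ℕ) : MixedForm ι κ V →ₗ[ℂ] MixedForm ι κ V :=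
  ∑ a : ι → Fin n, ∑ ω : Equiv.Perm ι,
    if a ∘ ω = a then (MultilinearMap.domDomCongrLinearEquiv ℂ ℂ V _ ω).toLinearMap else 0

theorem traceOperator_apply [Fintype ι] [DecidableEq ι] (G : MixedForm ι κ V) (u : ι → V)
    (ξ : κ → Dual ℂ V) :
    traceOperator ι κ V n G u ξ = ∑ a : ι → Fin n, ∑ ω : Equiv.Perm ι,
      if a ∘ ω = a then G (fun i => u (ω i)) ξ else 0 := by
  simp only [traceOperator, LinearMap.sum_apply, sum_apply]
  refine Finset.sum_congr rfl fun a _ => Finset.sum_congr rfl fun ω _ => ?_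
  split_ifs <;> simp

theorem traceOperator_mem_covariants [Fintype ι] [DecidableEq ι] {G : MixedForm ι κ V}
    (hG : G ∈ covariants ι κ V t) :
    traceOperator ι κ V n G ∈ covariants ι κ V t := by
  intro g v ξ
  simp only [traceOperator_apply, Finset.mul_sum]
  refine Finset.sum_congr rfl fun a _ => Finset.sum_congr rfl fun ω _ => ?_
  split_ifs
  · exact hG g (fun i => v (ω i)) ξ
  · simp

theorem traceOperator_injective [Fintype ι] [DecidableEq ι] (b : Basis (Fin n) ℂ V) :
    Function.Injective (traceOperator ι κ V n) := by
  rw [← LinearMap.ker_eq_bot, LinearMap.ker_eq_bot']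
  intro G hG
  refine Basis.ext_multilinear (fun _ => b) fun c => ?_
  ext ξ
  refine eq_zero_of_sum_fixed_eq_zero (fun c => G (fun i => b (c i)) ξ) (fun c => ?_) c
  have := traceOperator_apply (n := n) G (fun i => b (c i)) ξ
  rw [hG] at this
  exact this.symm

/-- The product of the evaluations of the covectors `ξ j` at the vectors `u (σ (inl j))` and of the
determinants of the blocks of the remaining vectors `u (σ (inr (l, k)))`. -/
noncomputable def contraction [Fintype κ] (b : Basis (Fin n) ℂ V)
    (σ : Equiv.Perm (κ ⊕ Fin t × Fin n))
    (u : κ ⊕ Fin t × Fin n → V) (ξ : κ → Dual ℂ V) : ℂ :=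
  (∏ j, ξ j (u (σ (Sum.inl j)))) * ∏ l, b.det fun k => u (σ (Sum.inr (l, k)))

/-- A polarization of `g ↦ (det g)ᵗ G(v, ξ ∘ g)`: a multilinear function of a family of
endomorphisms which takes this value on the constant family `g`. -/
noncomputable def polarizedDet (b : Basis (Fin n) ℂ V) (G : MixedForm ι κ V) (v : ι → V)
    (ξ : κ → Dual ℂ V) (t : ℕ) :
    MultilinearMap ℂ (fun _ : κ ⊕ Fin t × Fin n => V →ₗ[ℂ] V) ℂ :=
  (LinearMap.mul' ℂ ℂ).compMultilinearMap <|
    MultilinearMap.domCoprod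
      ((G v).compLinearMap fun j => (LinearMap.compRight ℂ (ξ j) : (V →ₗ[ℂ] V) →ₗ[ℂ] Dual ℂ V))
      (((MultilinearMap.mkPiAlgebra ℂ (Fin t) ℂ).compMultilinearMap fun _ =>
        b.det.toMultilinearMap.compLinearMap fun k : Fin n =>
          (LinearMap.applyₗ (b k) : (V →ₗ[ℂ] V) →ₗ[ℂ] V)).domDomCongr
        (Equiv.sigmaEquivProd (Fin t) (Fin n)))

theorem polarizedDet_apply (b : Basis (Fin n) ℂ V) (G : MixedForm ι κ V) (v : ι → V)
    (ξ : κ → Dual ℂ V) (g : κ ⊕ Fin t × Fin n → V →ₗ[ℂ] V) :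
    polarizedDet b G v ξ t g = G v (fun j => ξ j ∘ₗ g (Sum.inl j)) *
      ∏ l, b.det fun k => g (Sum.inr (l, k)) (b k) := by
  rfl

variable [Fintype κ] [DecidableEq κ]

/-- Polarizing the covariance identity of `G` and inserting rank one endomorphisms `η ⊗ u`
expresses the symmetrization of `G` through contractions of `u` and `ξ`. -/
theorem sum_perm_covariant (b : Basis (Fin n) ℂ V) {G : MixedForm (κ ⊕ Fin t × Fin n) κ V}
    (hG : G ∈ covariants (κ ⊕ Fin t × Fin n) κ V t) (η : κ ⊕ Fin t × Fin n → Dual ℂ V)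
    (v u : κ ⊕ Fin t × Fin n → V) (ξ : κ → Dual ℂ V) :
    ∑ ω : Equiv.Perm (κ ⊕ Fin t × Fin n), (∏ i, η (ω i) (v i)) * G (fun i => u (ω i)) ξ =
      ∑ ω : Equiv.Perm (κ ⊕ Fin t × Fin n),
        (G v (fun j => η (ω (Sum.inl j))) * ∏ l, ∏ k, η (ω (Sum.inr (l, k))) (b k)) *
          contraction b ω u ξ := by
  let L : MultilinearMap ℂ (fun _ : κ ⊕ Fin t × Fin n => V →ₗ[ℂ] V)
      (MultilinearMap ℂ (fun _ : κ => Dual ℂ V) ℂ) :=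
    G.compLinearMap fun i => (LinearMap.applyₗ (v i) : (V →ₗ[ℂ] V) →ₗ[ℂ] V)
  let ev : MultilinearMap ℂ (fun _ : κ => Dual ℂ V) ℂ →ₗ[ℂ] ℂ :=
    { toFun := fun H => H ξ, map_add' := fun _ _ => rfl, map_smul' := fun _ _ => rfl }
  have h := sum_perm_eq_sum_perm (L := ev.compMultilinearMap L) (L' := polarizedDet b G v ξ t)
    (fun g => by
      rw [polarizedDet_apply]
      refine (hG g v ξ).trans ?_
      rw [mul_comm]
      congr 1
      have hd := b.det_comp g b
      rw [b.det_self, mul_one] at hd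
      simp only [Finset.prod_const, Finset.card_univ, Fintype.card_fin]
      rw [← hd]
      rfl) (fun i => (η i).smulRight (u i))
  refine Eq.trans (Finset.sum_congr rfl fun ω _ => ?_) (h.trans (Finset.sum_congr rfl fun ω _ => ?_))
  · change _ = G (fun i => η (ω i) (v i) • u (ω i)) ξ
    rw [G.map_smul_univ]
    rfl
  · rw [polarizedDet_apply, contraction]
    have h1 : (fun j => ξ j ∘ₗ (η (ω (Sum.inl j))).smulRight (u (ω (Sum.inl j)))) =
        fun j => ξ j (u (ω (Sum.inl j))) • η (ω (Sum.inl j)) := by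
      ext j x
      simp [mul_comm]
    have h2 : ∀ l, (b.det fun k => (η (ω (Sum.inr (l, k)))).smulRight (u (ω (Sum.inr (l, k)))) (b k))
        = (∏ k, η (ω (Sum.inr (l, k))) (b k)) * b.det fun k => u (ω (Sum.inr (l, k))) := by
      intro l
      exact b.det.toMultilinearMap.map_smul_univ _ _
    rw [h1, (G v).map_smul_univ, Finset.prod_congr rfl fun l _ => h2 l, Finset.prod_mul_distrib,
      smul_eq_mul]
    ring

/-- The first fundamental theorem of invariant theory for the special linear group, in multilinear
form, for at least as many vectors as covectors: covariants are combinations of contractions. -/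
theorem covariant_mem_span (b : Basis (Fin n) ℂ V) {G : MixedForm (κ ⊕ Fin t × Fin n) κ V}
    (hG : G ∈ covariants (κ ⊕ Fin t × Fin n) κ V t) :
    (fun u ξ => G u ξ) ∈ Submodule.span ℂ (Set.range (contraction (κ := κ) (t := t) b)) := by
  have : Module.Finite ℂ V := Module.Finite.of_basis b
  let T := (traceOperator (κ ⊕ Fin t × Fin n) κ V n).restrict
    (p := covariants (κ ⊕ Fin t × Fin n) κ V t) fun _ h => traceOperator_mem_covariants h
  have hT : Function.Injective T := by
    intro x y hxy
    exact Subtype.ext (traceOperator_injective b (congrArg Subtype.val hxy))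
  have hs : Function.Surjective T := by
    have hf : Module.Finite ℂ (MixedForm (κ ⊕ Fin t × Fin n) κ V) := by
      have h1 : Module.Finite ℂ (MultilinearMap ℂ (fun _ : κ => Dual ℂ V) ℂ) := inferInstance
      have h2 : Module.Free ℂ (MultilinearMap ℂ (fun _ : κ => Dual ℂ V) ℂ) := inferInstance
      exact Module.Finite.multilinearMap
    have hf2 : FiniteDimensional ℂ (covariants (κ ⊕ Fin t × Fin n) κ V t) := inferInstance
    have := @LinearMap.injective_iff_surjective ℂ (covariants (κ ⊕ Fin t × Fin n) κ V t) _ _ _ hf2 T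
    exact this.1 hT
  obtain ⟨⟨G', hG'⟩, hT'⟩ := hs ⟨G, hG⟩
  obtain rfl : traceOperator _ _ V n G' = G := congrArg Subtype.val hT'
  have key : (fun u ξ => traceOperator (κ ⊕ Fin t × Fin n) κ V n G' u ξ) =
      ∑ a : κ ⊕ Fin t × Fin n → Fin n, ∑ ω : Equiv.Perm (κ ⊕ Fin t × Fin n),
        (G' (fun i => b (a i)) (fun j => b.coord (a (ω (Sum.inl j)))) *
          ∏ l, ∏ k, b.coord (a (ω (Sum.inr (l, k)))) (b k)) • contraction b ω := by
    ext u ξ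
    simp only [traceOperator_apply, Finset.sum_apply, Pi.smul_apply, smul_eq_mul]
    refine Finset.sum_congr rfl fun a _ => ?_
    rw [← sum_perm_covariant b hG' (fun i => b.coord (a i))]
    refine Finset.sum_congr rfl fun ω _ => ?_
    have : ∏ i, b.coord (a (ω i)) (b (a i)) = if a ∘ ω = a then 1 else 0 := by
      simp only [Basis.coord_apply, Basis.repr_self, Finsupp.single_apply]
      rw [Finset.prod_ite_zero]
      simp only [Finset.mem_univ, true_imp_iff, Finset.prod_const_one, funext_iff,
        Function.comp_apply]
      congr 1
      exact propext (forall_congr' fun i => eq_comm)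
    rw [this]
    split_ifs <;> simp
  rw [key]
  exact Submodule.sum_mem _ fun a _ => Submodule.sum_mem _ fun ω _ =>
    Submodule.smul_mem _ _ (Submodule.subset_span ⟨ω, rfl⟩)

end Covariant

/-! ### Nondegenerate hermitian forms -/

section Hermitian

variable {V : Type*} [AddCommGroup V] [Module ℂ V] {n : ℕ} {h : V →ₗ[ℂ] V →ₗ⋆[ℂ] ℂ}

/-- The endomorphism with the Gram matrix of `h` (transposed) as its matrix in the basis `b`. -/
noncomputable def gramEnd (b : Basis (Fin n) ℂ V) (h : V →ₗ[ℂ] V →ₗ⋆[ℂ] ℂ) : V →ₗ[ℂ] V :=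
  ∑ i, (h.flip (b i)).smulRight (b i)

theorem gramEnd_apply (b : Basis (Fin n) ℂ V) (v : V) :
    gramEnd b h v = ∑ i, h v (b i) • b i := by
  simp [gramEnd]

theorem gramEnd_injective (b : Basis (Fin n) ℂ V) (hnondeg : h.Nondegenerate) :
    Function.Injective (gramEnd b h) := by
  rw [← LinearMap.ker_eq_bot, LinearMap.ker_eq_bot']
  intro v hv
  rw [gramEnd_apply] at hv
  have h0 : ∀ i, h v (b i) = 0 := Fintype.linearIndependent_iff.1 b.linearIndependent _ hv
  have h1 : h v = 0 := b.ext fun i => by simp [h0 i]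
  exact hnondeg.1 v fun w => by simp [h1]

theorem gramEnd_surjective (b : Basis (Fin n) ℂ V) (hnondeg : h.Nondegenerate) :
    Function.Surjective (gramEnd b h) := by
  have : Module.Finite ℂ V := Module.Finite.of_basis b
  exact LinearMap.injective_iff_surjective.1 (gramEnd_injective b hnondeg)

/-- The conjugate-linear isomorphism `w ↦ h(·, w)` from `V` to its dual. -/
noncomputable def toDualEquiv (b : Basis (Fin n) ℂ V) (hherm : IsHermitianForm h)
    (hnondeg : h.Nondegenerate) : V ≃ₛₗ[starRingEnd ℂ] Dual ℂ V :=
  LinearEquiv.ofBijective (h.flip : V →ₛₗ[starRingEnd ℂ] Dual ℂ V) <| by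
    constructor
    · rw [← LinearMap.ker_eq_bot, LinearMap.ker_eq_bot']
      intro w hw
      exact hnondeg.2 w fun v => by simpa using LinearMap.congr_fun hw v
    · intro ξ
      obtain ⟨w, hw⟩ := gramEnd_surjective b hnondeg (∑ i, (starRingEnd ℂ) (ξ (b i)) • b i)
      refine ⟨w, b.ext fun i => ?_⟩
      rw [gramEnd_apply] at hw
      have h1 : h w (b i) = (starRingEnd ℂ) (ξ (b i)) := by
        have := congrArg (fun x => b.repr x i) hw
        simpa [Finsupp.single_apply] using this
      rw [LinearMap.flip_apply, hherm, h1, Complex.conj_conj]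

theorem toDualEquiv_apply (b : Basis (Fin n) ℂ V) (hherm : IsHermitianForm h)
    (hnondeg : h.Nondegenerate) (v w : V) : toDualEquiv b hherm hnondeg w v = h v w :=
  rfl

theorem exists_adjoint (b : Basis (Fin n) ℂ V) (hherm : IsHermitianForm h)
    (hnondeg : h.Nondegenerate) (X : V →ₗ[ℂ] V) :
    ∃ Y : V →ₗ[ℂ] V, (∀ v w, h (X v) w = h v (Y w)) ∧ ∀ v w, h (Y v) w = h v (X w) := by
  let θ := toDualEquiv b hherm hnondeg
  let Y : V →ₗ[ℂ] V :=
    { toFun := fun w => θ.symm (θ w ∘ₗ X)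
      map_add' := fun w w' => by simp [LinearMap.add_comp]
      map_smul' := fun c w => by
        rw [θ.map_smulₛₗ, LinearMap.smul_comp, θ.symm.map_smulₛₗ]
        simp }
  have hY : ∀ v w, h (X v) w = h v (Y w) := by
    intro v w
    have : θ (Y w) v = (θ w ∘ₗ X) v := by simp [Y]
    exact this.symm
  refine ⟨Y, hY, fun v w => ?_⟩
  rw [hherm, ← hY, hherm (X w), Complex.conj_conj]

theorem det_mul_conj_det_of_mem_unitaryGroup (b : Basis (Fin n) ℂ V) (hnondeg : h.Nondegenerate)
    {g : V ≃ₗ[ℂ] V} (hg : g ∈ unitaryGroup h) :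
    LinearMap.det (g : V →ₗ[ℂ] V) * (starRingEnd ℂ) (LinearMap.det (g : V →ₗ[ℂ] V)) = 1 := by
  have : Module.Finite ℂ V := Module.Finite.of_basis b
  let A := LinearMap.toMatrix b b (g.symm : V →ₗ[ℂ] V)
  have hA : ∀ i, g.symm (b i) = ∑ k, A k i • b k := by
    intro i
    have := (LinearMap.toMatrix b b).symm_apply_apply (g.symm : V →ₗ[ℂ] V)
    have h1 := congrArg (fun f => f (b i)) this
    simp only [LinearMap.toMatrix_symm, Matrix.toLin_self] at h1
    exact h1.symm
  have hcomp : gramEnd b h ∘ₗ (g : V →ₗ[ℂ] V) = Matrix.toLin b b A.conjTranspose ∘ₗ gramEnd b h := by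
    ext v
    have h1 : ∀ i, h (g v) (b i) = ∑ k, (starRingEnd ℂ) (A k i) * h v (b k) := by
      intro i
      have := hg v (g.symm (b i))
      rw [g.apply_symm_apply] at this
      rw [this, hA]
      simp
    simp only [LinearMap.comp_apply, LinearEquiv.coe_coe, gramEnd_apply, h1, map_sum, map_smul,
      Matrix.toLin_self, Finset.sum_smul, Finset.smul_sum]
    rw [Finset.sum_comm]
    refine Finset.sum_congr rfl fun k _ => Finset.sum_congr rfl fun i _ => ?_
    rw [smul_smul, mul_comm]
    rfl
  have hT : LinearMap.det (gramEnd b h) ≠ 0 := by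
    intro h0
    have := LinearMap.bot_lt_ker_of_det_eq_zero h0
    rw [LinearMap.ker_eq_bot.2 (gramEnd_injective b hnondeg)] at this
    exact lt_irrefl _ this
  have hd := congrArg LinearMap.det hcomp
  rw [LinearMap.det_comp, LinearMap.det_comp, LinearMap.det_toLin, Matrix.det_conjTranspose,
    mul_comm] at hd
  have hd' := mul_right_cancel₀ hT hd
  have hA' : A.det = LinearMap.det (g.symm : V →ₗ[ℂ] V) := LinearMap.det_toMatrix b _
  have h1 : LinearMap.det (g : V →ₗ[ℂ] V) * LinearMap.det (g.symm : V →ₗ[ℂ] V) = 1 := by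
    rw [← LinearMap.det_comp]
    simp
  have h2 := congrArg (starRingEnd ℂ) h1
  rw [map_mul, map_one] at h2
  nth_rewrite 1 [hd']
  rw [hA', mul_comm]
  exact h2

end Hermitian

/-! ### From the unitary group to all endomorphisms -/

section Density

/-- `φ` is given by a complex polynomial in one variable. -/
def IsPolynomialFun (φ : ℂ → ℂ) : Prop :=
  ∃ P : Polynomial ℂ, ∀ z, φ z = P.eval z

theorem IsPolynomialFun.mul {φ ψ : ℂ → ℂ} (hφ : IsPolynomialFun φ) (hψ : IsPolynomialFun ψ) :
    IsPolynomialFun fun z => φ z * ψ z := by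
  obtain ⟨P, hP⟩ := hφ
  obtain ⟨Q, hQ⟩ := hψ
  exact ⟨P * Q, fun z => by simp [hP, hQ]⟩

theorem IsPolynomialFun.sub {φ ψ : ℂ → ℂ} (hφ : IsPolynomialFun φ) (hψ : IsPolynomialFun ψ) :
    IsPolynomialFun fun z => φ z - ψ z := by
  obtain ⟨P, hP⟩ := hφ
  obtain ⟨Q, hQ⟩ := hψ
  exact ⟨P - Q, fun z => by simp [hP, hQ]⟩

theorem IsPolynomialFun.pow {φ : ℂ → ℂ} (hφ : IsPolynomialFun φ) (t : ℕ) :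
    IsPolynomialFun fun z => φ z ^ t := by
  obtain ⟨P, hP⟩ := hφ
  exact ⟨P ^ t, fun z => by simp [hP]⟩

theorem IsPolynomialFun.sum {α : Type*} {s : Finset α} {φ : α → ℂ → ℂ}
    (hφ : ∀ a, IsPolynomialFun (φ a)) : IsPolynomialFun fun z => ∑ a ∈ s, φ a z := by
  choose P hP using hφ
  exact ⟨∑ a ∈ s, P a, fun z => by simp [hP, Polynomial.eval_finsetSum]⟩

theorem isPolynomialFun_pow_mul_const (k : ℕ) (c : ℂ) : IsPolynomialFun fun z => z ^ k * c :=
  ⟨Polynomial.X ^ k * Polynomial.C c, fun z => by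
    rw [Polynomial.eval_mul, Polynomial.eval_pow, Polynomial.eval_X, Polynomial.eval_C]⟩

/-- A polynomial function vanishing at all real numbers outside the zeros of a second nonzero
polynomial function vanishes identically. -/
theorem IsPolynomialFun.eq_zero_of_real {φ ψ : ℂ → ℂ} (hφ : IsPolynomialFun φ)
    (hψ : IsPolynomialFun ψ) {z₀ : ℂ} (hz₀ : ψ z₀ ≠ 0)
    (h : ∀ x : ℝ, ψ x ≠ 0 → φ x = 0) (z : ℂ) : φ z = 0 := by
  obtain ⟨P, hP⟩ := hφ
  obtain ⟨Q, hQ⟩ := hψ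
  have hQ0 : Q ≠ 0 := by
    rintro rfl
    exact hz₀ (by simp [hQ])
  have hPQ : P * Q = 0 := by
    refine Polynomial.eq_zero_of_infinite_isRoot _ ?_
    refine Set.Infinite.mono ?_ (Set.infinite_range_of_injective Complex.ofReal_injective)
    rintro _ ⟨x, rfl⟩
    simp only [Set.mem_ofPred_eq, Polynomial.IsRoot.def, Polynomial.eval_mul, ← hP, ← hQ]
    by_cases hx : ψ x = 0
    · simp [hx]
    · simp [h x hx]
  rcases mul_eq_zero.1 hPQ with h0 | h0
  · simp [hP, h0]
  · exact absurd h0 hQ0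

theorem map_add_smul_univ {ι E M : Type*} [Fintype ι] [DecidableEq ι] [AddCommGroup E] [Module ℂ E]
    [AddCommGroup M] [Module ℂ M] (f : MultilinearMap ℂ (fun _ : ι => E) M) (x y : ι → E) (z : ℂ) :
    f (fun i => x i + z • y i) = ∑ S : Finset ι, z ^ S.card • f (S.piecewise y x) := by
  have h1 : (fun i => x i + z • y i) = (fun i => z • y i) + x := by
    ext i; simp [add_comm]
  rw [h1, f.map_add_univ]
  refine Finset.sum_congr rfl fun S _ => ?_
  have h2 : S.piecewise (fun i => z • y i) x =
      fun i => (if i ∈ S then z else 1) • S.piecewise y x i := by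
    ext i
    by_cases hi : i ∈ S <;> simp [hi]
  rw [h2, f.map_smul_univ]
  simp

variable {V : Type*} [AddCommGroup V] [Module ℂ V] {n t : ℕ} {h : V →ₗ[ℂ] V →ₗ⋆[ℂ] ℂ}
  {ι κ : Type*}

theorem isPolynomialFun_mixedForm [Fintype ι] [Fintype κ] (G : MixedForm ι κ V) (x y : ι → V)
    (ξ η : κ → Dual ℂ V) :
    IsPolynomialFun fun z => G (fun i => x i + z • y i) (fun j => ξ j + z • η j) := by
  classical
  simp only [map_add_smul_univ, sum_apply, smul_apply, smul_eq_mul,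
    Finset.mul_sum, ← mul_assoc, ← pow_add]
  exact IsPolynomialFun.sum fun S => IsPolynomialFun.sum fun T => isPolynomialFun_pow_mul_const _ _

theorem det_eq_basis_det (b : Basis (Fin n) ℂ V) (g : V →ₗ[ℂ] V) :
    LinearMap.det g = b.det fun i => g (b i) := by
  have := b.det_comp g b
  rw [b.det_self, mul_one] at this
  exact this.symm

theorem isPolynomialFun_det (b : Basis (Fin n) ℂ V) (A B : V →ₗ[ℂ] V) :
    IsPolynomialFun fun z => LinearMap.det (A + z • B) := by
  simp only [det_eq_basis_det b, LinearMap.add_apply, LinearMap.smul_apply]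
  have := fun z => map_add_smul_univ b.det.toMultilinearMap (fun i => A (b i)) (fun i => B (b i)) z
  simp only [AlternatingMap.coe_multilinearMap] at this
  simp only [this]
  exact IsPolynomialFun.sum fun S => isPolynomialFun_pow_mul_const _ _

/-- The identity `G(gv, ξ) = (det g)ᵗ G(v, ξ ∘ g)` for `g = AB⁻¹`, where `A` and `B` commute, with
denominators cleared, so that it makes sense for noninvertible `B` too. -/
def CovariantQuotient (G : MixedForm ι κ V) (t : ℕ) (A B : V →ₗ[ℂ] V) : Prop :=
  ∀ (v : ι → V) (η : κ → Dual ℂ V),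
    LinearMap.det B ^ t * G (fun i => A (v i)) (fun j => η j ∘ₗ B) =
      LinearMap.det A ^ t * G (fun i => B (v i)) (fun j => η j ∘ₗ A)

/-- `CovariantQuotient` on the line `A = A₀ + zA₁`, `B = B₀ + zB₁` is a polynomial identity in `z`,
so it may be checked at the real `z` outside a proper algebraic subset. -/
theorem CovariantQuotient.of_real [Fintype ι] [Fintype κ] (b : Basis (Fin n) ℂ V)
    {G : MixedForm ι κ V} {A₀ A₁ B₀ B₁ : V →ₗ[ℂ] V} {ψ : ℂ → ℂ} (hψ : IsPolynomialFun ψ) {z₀ : ℂ}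
    (hz₀ : ψ z₀ ≠ 0) (hreal : ∀ x : ℝ, ψ x ≠ 0 →
      CovariantQuotient G t (A₀ + (x : ℂ) • A₁) (B₀ + (x : ℂ) • B₁)) (z : ℂ) :
    CovariantQuotient G t (A₀ + z • A₁) (B₀ + z • B₁) := by
  intro v η
  rw [← sub_eq_zero]
  refine IsPolynomialFun.eq_zero_of_real
    (φ := fun z => LinearMap.det (B₀ + z • B₁) ^ t * G (fun i => (A₀ + z • A₁) (v i))
      (fun j => η j ∘ₗ (B₀ + z • B₁)) - LinearMap.det (A₀ + z • A₁) ^ t *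
      G (fun i => (B₀ + z • B₁) (v i)) (fun j => η j ∘ₗ (A₀ + z • A₁))) ?_ hψ hz₀ ?_ z
  · simp only [LinearMap.add_apply, LinearMap.smul_apply, LinearMap.comp_add, LinearMap.comp_smul]
    exact (((isPolynomialFun_det b _ _).pow t).mul (isPolynomialFun_mixedForm G _ _ _ _)).sub
      (((isPolynomialFun_det b _ _).pow t).mul (isPolynomialFun_mixedForm G _ _ _ _))
  · intro x hx
    exact sub_eq_zero.2 (hreal x hx v η)

/-- `X` is skew-adjoint with respect to `h`. -/
def IsSkew (h : V →ₗ[ℂ] V →ₗ⋆[ℂ] ℂ) (X : V →ₗ[ℂ] V) : Prop :=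
  ∀ v w, h (X v) w = -h v (X w)

/-- The Cayley transform `(1 + X)(1 - X)⁻¹` of a skew-adjoint `X` is unitary. -/
theorem covariantQuotient_of_isSkew_of_det_ne_zero (b : Basis (Fin n) ℂ V) {G : MixedForm ι κ V}
    (hU : ∀ g ∈ unitaryGroup h, ∀ (v : ι → V) (ξ : κ → Dual ℂ V),
      G (fun i => g (v i)) ξ =
        LinearMap.det (g : V →ₗ[ℂ] V) ^ t * G v (fun j => ξ j ∘ₗ (g : V →ₗ[ℂ] V)))
    {X : V →ₗ[ℂ] V} (hX : IsSkew h X) (h1 : LinearMap.det (LinearMap.id + X) ≠ 0)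
    (h2 : LinearMap.det (LinearMap.id - X) ≠ 0) :
    CovariantQuotient G t (LinearMap.id + X) (LinearMap.id - X) := by
  have : Module.Finite ℂ V := Module.Finite.of_basis b
  intro v η
  let A := LinearMap.equivOfDetNeZero _ h1
  let B := LinearMap.equivOfDetNeZero _ h2
  have hA : ∀ x, A x = x + X x := fun _ => rfl
  have hB : ∀ x, B x = x - X x := fun _ => rfl
  have hBB : ∀ x, B.symm (x - X x) = x := fun x => by rw [← hB, B.symm_apply_apply]
  have hAB : ∀ x, A (B.symm x) = B.symm (A x) := by
    intro x
    obtain ⟨y, rfl⟩ := B.surjective x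
    rw [B.symm_apply_apply, LinearEquiv.eq_symm_apply]
    simp only [hA, hB, map_add, map_sub]
    abel
  let g : V ≃ₗ[ℂ] V := B.symm.trans A
  have hg : g ∈ unitaryGroup h := by
    intro x y
    obtain ⟨x, rfl⟩ := B.surjective x
    obtain ⟨y, rfl⟩ := B.surjective y
    simp only [g, LinearEquiv.trans_apply, B.symm_apply_apply]
    simp only [hA, hB, map_add, map_sub, LinearMap.add_apply, LinearMap.sub_apply, hX x]
    ring
  have hdet : LinearMap.det (g : V →ₗ[ℂ] V) * LinearMap.det (LinearMap.id - X) =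
      LinearMap.det (LinearMap.id + X) := by
    rw [← LinearMap.det_comp]
    congr 1
    ext x
    simp [g, hBB, hA]
  have key := hU g hg (fun i => (LinearMap.id - X : V →ₗ[ℂ] V) (v i))
    (fun j => η j ∘ₗ (LinearMap.id - X))
  have e1 : ∀ i, g ((LinearMap.id - X : V →ₗ[ℂ] V) (v i)) =
      (LinearMap.id + X : V →ₗ[ℂ] V) (v i) := by
    intro i
    simp [g, hBB, hA]
  have e2 : ∀ j, (η j ∘ₗ (LinearMap.id - X)) ∘ₗ (g : V →ₗ[ℂ] V) = η j ∘ₗ (LinearMap.id + X) := by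
    intro j
    ext x
    have : B (g x) = A x := by
      simp only [g, LinearEquiv.trans_apply, hAB, B.apply_symm_apply]
    exact congrArg (η j) this
  simp only [e1, e2] at key
  rw [key, ← hdet, mul_pow]
  ring

theorem IsSkew.smul_real {X : V →ₗ[ℂ] V} (hX : IsSkew h X) (x : ℝ) : IsSkew h ((x : ℂ) • X) := by
  intro v w
  simp only [LinearMap.smul_apply, map_smulₛₗ, RingHom.id_apply, Complex.conj_ofReal, hX v w,
    smul_eq_mul, mul_neg]

theorem IsSkew.add {X Y : V →ₗ[ℂ] V} (hX : IsSkew h X) (hY : IsSkew h Y) : IsSkew h (X + Y) := by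
  intro v w
  simp only [LinearMap.add_apply, map_add, hX v w, hY v w]
  ring

/-- The skew-adjoint endomorphisms form a real form of the space of all endomorphisms. -/
theorem exists_isSkew_add_I_smul (b : Basis (Fin n) ℂ V) (hherm : IsHermitianForm h)
    (hnondeg : h.Nondegenerate) (X : V →ₗ[ℂ] V) :
    ∃ A B : V →ₗ[ℂ] V, IsSkew h A ∧ IsSkew h B ∧ X = A + Complex.I • B := by
  obtain ⟨Y, hY, hY'⟩ := exists_adjoint b hherm hnondeg X
  refine ⟨(1 / 2 : ℂ) • (X - Y), (-Complex.I / 2) • (X + Y), ?_, ?_, ?_⟩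
  · intro v w
    simp [hY, hY', Complex.conj_ofNat]
    ring
  · intro v w
    simp [hY, hY', Complex.conj_ofNat]
    ring
  · rw [smul_smul, mul_div_assoc', mul_neg, Complex.I_mul_I]
    ext v
    simp only [LinearMap.add_apply, LinearMap.smul_apply, LinearMap.sub_apply]
    module

/-- A relative invariant of the unitary group satisfies the covariance identity for all
endomorphisms: the unitary group is Zariski dense. -/
theorem mem_covariants_of_unitaryGroup [Fintype ι] [Fintype κ] (b : Basis (Fin n) ℂ V)
    (hherm : IsHermitianForm h) (hnondeg : h.Nondegenerate)
    (hcard : Fintype.card ι = n * t + Fintype.card κ) {G : MixedForm ι κ V}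
    (hU : ∀ g ∈ unitaryGroup h, ∀ (v : ι → V) (ξ : κ → Dual ℂ V),
      G (fun i => g (v i)) ξ =
        LinearMap.det (g : V →ₗ[ℂ] V) ^ t * G v (fun j => ξ j ∘ₗ (g : V →ₗ[ℂ] V))) :
    G ∈ covariants ι κ V t := by
  have : Module.Finite ℂ V := Module.Finite.of_basis b
  -- Scale `X` by real numbers to reach skew-adjoint `X` for which `1 ± X` is not invertible.
  have hskew : ∀ X, IsSkew h X → CovariantQuotient G t (LinearMap.id + X) (LinearMap.id - X) := by
    intro X hX
    have := CovariantQuotient.of_real (G := G) (t := t) b (A₀ := LinearMap.id) (A₁ := X)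
      (B₀ := LinearMap.id) (B₁ := -X)
      ((isPolynomialFun_det b LinearMap.id X).mul (isPolynomialFun_det b LinearMap.id (-X)))
      (z₀ := 0) (by simp) (fun x hx => by
        have hx' := mul_ne_zero_iff.1 hx
        simp only [smul_neg, ← sub_eq_add_neg] at hx' ⊢
        exact covariantQuotient_of_isSkew_of_det_ne_zero b hU (hX.smul_real x) hx'.1 hx'.2) 1
    simpa [← sub_eq_add_neg] using this
  -- Move along `A + zB` with `A`, `B` skew-adjoint from real `z` to `z = i`.
  have hall : ∀ X, CovariantQuotient G t (LinearMap.id + X) (LinearMap.id - X) := by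
    intro X
    obtain ⟨A, B, hA, hB, rfl⟩ := exists_isSkew_add_I_smul b hherm hnondeg X
    have := CovariantQuotient.of_real (G := G) (t := t) b (A₀ := LinearMap.id + A) (A₁ := B)
      (B₀ := LinearMap.id - A) (B₁ := -B) (ψ := fun _ => 1) ⟨1, by simp⟩ (z₀ := 0) one_ne_zero
      (fun x _ => by
        have := hskew _ (hA.add (hB.smul_real x))
        rwa [← add_assoc, ← sub_sub, sub_eq_add_neg _ ((x : ℂ) • B), ← smul_neg] at this)
      Complex.I
    rwa [smul_neg, ← sub_eq_add_neg, sub_sub, add_assoc] at this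
  -- Every `g` for which `1 + g` is invertible is of the form `(1 + X)(1 - X)⁻¹`.
  have hgen : ∀ g : V →ₗ[ℂ] V, LinearMap.det (LinearMap.id + g) ≠ 0 →
      ∀ (v : ι → V) (ξ : κ → Dual ℂ V),
        G (fun i => g (v i)) ξ = LinearMap.det g ^ t * G v (fun j => ξ j ∘ₗ g) := by
    intro g hg v ξ
    let C := LinearMap.equivOfDetNeZero _ hg
    have hC : ∀ x, C x = x + g x := fun _ => rfl
    have hCs : ∀ x, C.symm x + g (C.symm x) = x := fun x => by rw [← hC, C.apply_symm_apply]
    have hCg : ∀ x, C.symm (g x) = g (C.symm x) := by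
      intro x
      rw [LinearEquiv.symm_apply_eq, hC, ← map_add, hCs]
    let c : V →ₗ[ℂ] V := (2 : ℂ) • (C.symm : V →ₗ[ℂ] V)
    have e1 : LinearMap.id + (LinearMap.id - c) = g ∘ₗ c := by
      ext x
      have := hCs x
      simp only [c, LinearMap.add_apply, LinearMap.id_apply, LinearMap.sub_apply,
        LinearMap.smul_apply, LinearEquiv.coe_coe, LinearMap.comp_apply, map_smul]
      rw [eq_sub_of_add_eq' this]
      module
    have e2 : LinearMap.id - (LinearMap.id - c) = c := by simp
    have hdetc : LinearMap.det c ≠ 0 := by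
      simp only [c, LinearMap.det_smul]
      exact mul_ne_zero (pow_ne_zero _ two_ne_zero) (LinearEquiv.isUnit_det' C.symm).ne_zero
    have := hall (LinearMap.id - c) (fun i => (1 / 2 : ℂ) • C (v i))
      (fun j => (1 / 2 : ℂ) • ξ j ∘ₗ (C : V →ₗ[ℂ] V))
    rw [e1, e2, LinearMap.det_comp, mul_comm (LinearMap.det g), mul_pow, mul_assoc] at this
    have key := mul_left_cancel₀ (pow_ne_zero t hdetc) this
    have f1 : ∀ x, c ((1 / 2 : ℂ) • C x) = x := fun x => by simp [c]
    have f2 : ∀ j, ((1 / 2 : ℂ) • ξ j ∘ₗ (C : V →ₗ[ℂ] V)) ∘ₗ c = ξ j := by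
      intro j; ext x; simp [c]
    have f3 : ∀ j, ((1 / 2 : ℂ) • ξ j ∘ₗ (C : V →ₗ[ℂ] V)) ∘ₗ g ∘ₗ c = ξ j ∘ₗ g := by
      intro j; ext x; simp [c, ← hCg]
    simpa only [LinearMap.comp_apply, f1, f2, f3] using key
  intro g v ξ
  -- Both sides are homogeneous in `g`, and `1 + zg` is invertible for some `z ≠ 0`.
  obtain ⟨z, hz0, hz⟩ : ∃ z : ℂ, z ≠ 0 ∧ LinearMap.det (LinearMap.id + z • g) ≠ 0 := by
    by_contra! hcon
    have := IsPolynomialFun.eq_zero_of_real (isPolynomialFun_det b LinearMap.id g)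
      (ψ := fun z => z) ⟨Polynomial.X, by simp⟩ (z₀ := 1) one_ne_zero (fun x hx => hcon x hx) 0
    simp at this
  have key := hgen (z • g) hz v ξ
  have e1 : G (fun i => (z • g) (v i)) ξ = z ^ Fintype.card ι * G (fun i => g (v i)) ξ := by
    have := G.map_smul_univ (fun _ => z) (fun i => g (v i))
    simp only [Finset.prod_const, Finset.card_univ] at this
    simp [this]
  have e2 : G v (fun j => ξ j ∘ₗ (z • g)) = z ^ Fintype.card κ * G v (fun j => ξ j ∘ₗ g) := by
    have := (G v).map_smul_univ (fun _ => z) (fun j => ξ j ∘ₗ g)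
    simp only [Finset.prod_const, Finset.card_univ] at this
    simp [this, LinearMap.comp_smul]
  rw [e1, e2, LinearMap.det_smul, finrank_eq_card_basis b, Fintype.card_fin, mul_pow, ← pow_mul,
    hcard, pow_add] at key
  refine mul_left_cancel₀ (mul_ne_zero (pow_ne_zero (n * t) hz0)
    (pow_ne_zero (Fintype.card κ) hz0)) ?_
  rw [key]
  ring

end Density

/-! ### From the special unitary to the unitary group -/

section SpecialUnitary

variable {V : Type*} [AddCommGroup V] [Module ℂ V] {n t : ℕ} {h : V →ₗ[ℂ] V →ₗ⋆[ℂ] ℂ}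
  {ι κ : Type*}

theorem mem_specialUnitaryGroup_iff {g : V ≃ₗ[ℂ] V} :
    g ∈ specialUnitaryGroup h ↔ g ∈ unitaryGroup h ∧ LinearMap.det (g : V →ₗ[ℂ] V) = 1 := by
  rw [specialUnitaryGroup, Subgroup.mem_inf, MonoidHom.mem_ker, ← LinearEquiv.coe_det,
    Units.val_eq_one]

theorem mixedForm_smul_left [Fintype ι] (G : MixedForm ι κ V) (c : ℂ) (v : ι → V)
    (ξ : κ → Dual ℂ V) : G (fun i => c • v i) ξ = c ^ Fintype.card ι * G v ξ := by
  have := G.map_smul_univ (fun _ => c) v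
  simp only [Finset.prod_const, Finset.card_univ] at this
  simp [this]

theorem mixedForm_smul_right [Fintype κ] (G : MixedForm ι κ V) (c : ℂ) (v : ι → V)
    (ξ : κ → Dual ℂ V) : G v (fun j => c • ξ j) = c ^ Fintype.card κ * G v ξ := by
  have := (G v).map_smul_univ (fun _ => c) ξ
  simp only [Finset.prod_const, Finset.card_univ] at this
  simp [this]

/-- A unitary map times a complex number of absolute value one is unitary. -/
theorem smul_trans_mem_unitaryGroup {g : V ≃ₗ[ℂ] V} (hg : g ∈ unitaryGroup h) {c : ℂ}
    (hc0 : c ≠ 0) (hc : c * (starRingEnd ℂ) c = 1) :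
    g.trans (LinearEquiv.smulOfNeZero ℂ V c hc0) ∈ unitaryGroup h := by
  intro v w
  have : ∀ x, g.trans (LinearEquiv.smulOfNeZero ℂ V c hc0) x = c • g x := fun _ => rfl
  simp only [this, map_smulₛₗ, LinearMap.smul_apply, RingHom.id_apply, smul_eq_mul, hg v w]
  linear_combination h v w * hc

theorem det_trans_smul (b : Basis (Fin n) ℂ V) (g : V ≃ₗ[ℂ] V) {c : ℂ} (hc0 : c ≠ 0) :
    LinearMap.det ((g.trans (LinearEquiv.smulOfNeZero ℂ V c hc0) : V ≃ₗ[ℂ] V) : V →ₗ[ℂ] V) =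
      c ^ n * LinearMap.det (g : V →ₗ[ℂ] V) := by
  have : ((g.trans (LinearEquiv.smulOfNeZero ℂ V c hc0) : V ≃ₗ[ℂ] V) : V →ₗ[ℂ] V) =
      c • (g : V →ₗ[ℂ] V) := rfl
  rw [this, LinearMap.det_smul, finrank_eq_card_basis b, Fintype.card_fin]

/-- The `n`-th roots of unity lie in the special unitary group, so a nonzero invariant has as many
vectors as covectors modulo `n`. -/
theorem dvd_card_sub_card [Fintype ι] [Fintype κ] (b : Basis (Fin n) ℂ V) {G : MixedForm ι κ V}
    (hG : G ≠ 0) (hSU : ∀ g ∈ specialUnitaryGroup h, ∀ (v : ι → V) (ξ : κ → Dual ℂ V),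
      G (fun i => g (v i)) ξ = G v (fun j => ξ j ∘ₗ (g : V →ₗ[ℂ] V))) :
    (n : ℤ) ∣ (Fintype.card ι : ℤ) - Fintype.card κ := by
  obtain ⟨v, ξ, hvξ⟩ : ∃ v ξ, G v ξ ≠ 0 := by
    by_contra! hcon
    exact hG (by ext v ξ; exact hcon v ξ)
  rcases Nat.eq_zero_or_pos n with rfl | hn
  · have hsub : Subsingleton V := b.repr.toEquiv.subsingleton
    have h1 : IsEmpty ι := ⟨fun i => hvξ (by
      rw [G.map_coord_zero i (Subsingleton.elim _ _)]; rfl)⟩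
    have h2 : IsEmpty κ := ⟨fun j => hvξ ((G v).map_coord_zero j (by
      ext x; rw [Subsingleton.elim x 0, map_zero, map_zero]))⟩
    simp
  · have hζ := Complex.isPrimitiveRoot_exp n hn.ne'
    set ζ := Complex.exp (2 * Real.pi * Complex.I / n)
    have hζ0 : ζ ≠ 0 := hζ.ne_zero hn.ne'
    have hnorm : ζ * (starRingEnd ℂ) ζ = 1 := by
      rw [Complex.mul_conj, Complex.normSq_eq_norm_sq, hζ.norm'_eq_one hn.ne']
      simp
    have hmem := smul_trans_mem_unitaryGroup (h := h) (one_mem _) hζ0 hnorm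
    have hdet := det_trans_smul b 1 hζ0
    rw [hζ.pow_eq_one, one_mul] at hdet
    have key := hSU _ (mem_specialUnitaryGroup_iff.2 ⟨hmem, hdet.trans (by
      rw [← LinearEquiv.coe_det, map_one, Units.val_one])⟩) v ξ
    have key' : G (fun i => ζ • v i) ξ = G v (fun j => ζ • ξ j) := by
      refine key.trans (congrArg _ (funext fun j => ?_))
      ext x
      exact (ξ j).map_smul ζ x
    rw [mixedForm_smul_left, mixedForm_smul_right] at key'
    rw [← hζ.zpow_eq_one_iff_dvd, zpow_sub₀ hζ0, zpow_natCast, zpow_natCast,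
      mul_right_cancel₀ hvξ key', div_self (pow_ne_zero _ hζ0)]

/-- The unitary group is generated by the special unitary group and the scalars of absolute value
one, so an invariant of the former is a relative invariant of the latter. -/
theorem relative_invariant_of_specialUnitaryGroup [Fintype ι] [Fintype κ] (b : Basis (Fin n) ℂ V)
    (hnondeg : h.Nondegenerate) (hcard : Fintype.card ι = n * t + Fintype.card κ)
    {G : MixedForm ι κ V}
    (hSU : ∀ g ∈ specialUnitaryGroup h, ∀ (v : ι → V) (ξ : κ → Dual ℂ V),
      G (fun i => g (v i)) ξ = G v (fun j => ξ j ∘ₗ (g : V →ₗ[ℂ] V)))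
    {g : V ≃ₗ[ℂ] V} (hg : g ∈ unitaryGroup h) (v : ι → V) (ξ : κ → Dual ℂ V) :
    G (fun i => g (v i)) ξ =
      LinearMap.det (g : V →ₗ[ℂ] V) ^ t * G v (fun j => ξ j ∘ₗ (g : V →ₗ[ℂ] V)) := by
  have hd := det_mul_conj_det_of_mem_unitaryGroup b hnondeg hg
  set d := LinearMap.det (g : V →ₗ[ℂ] V)
  -- An `n`-th root `c` of `det g` has absolute value one, and `c⁻¹ g` is special unitary.
  obtain ⟨c, hc, hcn⟩ : ∃ c : ℂ, c * (starRingEnd ℂ) c = 1 ∧ c ^ n = d := by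
    rcases Nat.eq_zero_or_pos n with rfl | hn
    · refine ⟨1, by simp, ?_⟩
      rw [pow_zero]
      simp [d, det_eq_basis_det b]
    · obtain ⟨c, hc⟩ := IsAlgClosed.exists_pow_nat_eq d hn
      refine ⟨c, ?_, hc⟩
      rw [Complex.mul_conj, Complex.normSq_eq_norm_sq] at hd ⊢
      have h1 : ‖d‖ = 1 := by
        have : ‖d‖ ^ 2 = 1 := by exact_mod_cast hd
        exact (pow_eq_one_iff_of_nonneg (norm_nonneg _) two_ne_zero).1 this
      rw [← hc, norm_pow] at h1
      rw [(pow_eq_one_iff_of_nonneg (norm_nonneg _) hn.ne').1 h1]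
      simp
  have hc0 : c ≠ 0 := by
    rintro rfl
    simp at hc
  have hci : c⁻¹ * (starRingEnd ℂ) c⁻¹ = 1 := by
    rw [map_inv₀, ← mul_inv, hc, inv_one]
  have hmem := smul_trans_mem_unitaryGroup hg (inv_ne_zero hc0) hci
  have hdet := det_trans_smul b g (inv_ne_zero hc0)
  have hd0 : d ≠ 0 := left_ne_zero_of_mul_eq_one hd
  rw [inv_pow, hcn] at hdet
  have key := hSU _ (mem_specialUnitaryGroup_iff.2 ⟨hmem, hdet.trans (inv_mul_cancel₀ hd0)⟩)
    (fun i => c • v i) (fun j => c • ξ j)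
  have e1 : ∀ i, (g.trans (LinearEquiv.smulOfNeZero ℂ V c⁻¹ (inv_ne_zero hc0))) (c • v i) =
      g (v i) := by
    intro i
    change c⁻¹ • g (c • v i) = _
    rw [map_smul, inv_smul_smul₀ hc0]
  have e2 : ∀ j, (c • ξ j) ∘ₗ ((g.trans (LinearEquiv.smulOfNeZero ℂ V c⁻¹ (inv_ne_zero hc0)) :
      V ≃ₗ[ℂ] V) : V →ₗ[ℂ] V) = ξ j ∘ₗ (g : V →ₗ[ℂ] V) := by
    intro j
    ext x
    change c • ξ j (c⁻¹ • g x) = ξ j (g x)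
    rw [map_smul, smul_inv_smul₀ hc0]
  simp only [e1, e2] at key
  rw [mixedForm_smul_left, mixedForm_smul_right, hcard, pow_add, pow_mul, hcn,
    mul_comm (d ^ t), mul_assoc] at key
  exact mul_left_cancel₀ (pow_ne_zero _ hc0) key

/-- The first fundamental theorem for the special unitary group, in multilinear form and for at
least as many vectors as covectors. -/
theorem mem_span_contraction_of_specialUnitaryGroup [Fintype κ] [DecidableEq κ]
    (b : Basis (Fin n) ℂ V) (hherm : IsHermitianForm h) (hnondeg : h.Nondegenerate)
    {G : MixedForm (κ ⊕ Fin t × Fin n) κ V}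
    (hSU : ∀ g ∈ specialUnitaryGroup h, ∀ (v : κ ⊕ Fin t × Fin n → V) (ξ : κ → Dual ℂ V),
      G (fun i => g (v i)) ξ = G v (fun j => ξ j ∘ₗ (g : V →ₗ[ℂ] V))) :
    (fun u ξ => G u ξ) ∈ Submodule.span ℂ (Set.range (contraction (κ := κ) (t := t) b)) := by
  have hcard : Fintype.card (κ ⊕ Fin t × Fin n) = n * t + Fintype.card κ := by
    simp [mul_comm, add_comm]
  exact covariant_mem_span b (mem_covariants_of_unitaryGroup b hherm hnondeg hcard
    fun g hg => relative_invariant_of_specialUnitaryGroup b hnondeg hcard hSU hg)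

end SpecialUnitary

/-! ### The forms `basicInvariant` -/

section Basic

variable {V : Type*} [AddCommGroup V] [Module ℂ V] {n m s r : ℕ} {h : V →ₗ[ℂ] V →ₗ⋆[ℂ] ℂ}

/-- The numbering of the arguments of `basicInvariant`: `m` pairs, followed by `s` blocks of
length `n`. -/
def blockEquiv (hr : r = 2 * m + n * s) : (Fin m × Fin 2) ⊕ (Fin s × Fin n) ≃ Fin r :=
  ((Equiv.sumCongr finProdFinEquiv finProdFinEquiv).trans finSumFinEquiv).trans
    (finCongr (by rw [hr, mul_comm m, mul_comm s]))

theorem blockEquiv_inl_zero (hr : r = 2 * m + n * s) (j : Fin m) :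
    blockEquiv hr (Sum.inl (j, 0)) = ⟨2 * (j : ℕ), by omega⟩ := by
  ext; simp [blockEquiv, finProdFinEquiv]

theorem blockEquiv_inl_one (hr : r = 2 * m + n * s) (j : Fin m) :
    blockEquiv hr (Sum.inl (j, 1)) = ⟨2 * (j : ℕ) + 1, by omega⟩ := by
  ext; simp [blockEquiv, finProdFinEquiv, add_comm]

theorem blockEquiv_inr (hr : r = 2 * m + n * s) (l : Fin s) (k : Fin n) :
    blockEquiv hr (Sum.inr (l, k)) = ⟨2 * m + n * (l : ℕ) + (k : ℕ), block_lt hr l k⟩ := by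
  ext; simp [blockEquiv, finProdFinEquiv]; ring

theorem basicInvariant_eq (b : Basis (Fin n) ℂ V) (hr : r = 2 * m + n * s)
    (σ : Equiv.Perm (Fin r)) (δ : Fin m → Fin 2) (v : Fin r → V) :
    basicInvariant h b hr σ δ v =
      (∏ j, (pairing h (v (σ (blockEquiv hr (Sum.inl (j, 0)))))
        (Complex.I ^ (δ j : ℕ) • v (σ (blockEquiv hr (Sum.inl (j, 1))))) : ℂ)) *
      ∏ l, b.det fun k => v (σ (blockEquiv hr (Sum.inr (l, k)))) := by
  simp only [basicInvariant, blockEquiv_inl_zero, blockEquiv_inl_one, blockEquiv_inr]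

/-- The pairing `⟨v₀, c v₁⟩` as a real bilinear form with complex values. -/
noncomputable def pairingForm (h : V →ₗ[ℂ] V →ₗ⋆[ℂ] ℂ) (c : ℂ) :
    MultilinearMap ℝ (fun _ : Fin 2 => V) ℂ :=
  MultilinearMap.mk' (fun v => (pairing h (v 0) (c • v 1) : ℂ))
    (by
      intro v i x y
      fin_cases i
      · simp [pairing]; ring
      · simp [pairing])
    (by
      intro v i a x
      have h1 : ∀ x : V, a • x = (a : ℂ) • x := fun x => (Complex.coe_smul a x).symm
      fin_cases i <;>
        (simp only [pairing, h1]; simp [-Complex.coe_smul]; ring))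

/-- `basicInvariant` as a real multilinear map. -/
noncomputable def basicForm (h : V →ₗ[ℂ] V →ₗ⋆[ℂ] ℂ) (b : Basis (Fin n) ℂ V)
    (hr : r = 2 * m + n * s) (σ : Equiv.Perm (Fin r)) (δ : Fin m → Fin 2) :
    MultilinearMap ℝ (fun _ : Fin r => V) ℂ :=
  ((LinearMap.mul' ℝ ℂ).compMultilinearMap <|
    MultilinearMap.domCoprod
      (((MultilinearMap.mkPiAlgebra ℝ (Fin m) ℂ).compMultilinearMap fun j =>
        pairingForm h (Complex.I ^ (δ j : ℕ))).domDomCongr (Equiv.sigmaEquivProd (Fin m) (Fin 2)))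
      (((MultilinearMap.mkPiAlgebra ℝ (Fin s) ℂ).compMultilinearMap fun _ =>
        b.det.toMultilinearMap.restrictScalars ℝ).domDomCongr
          (Equiv.sigmaEquivProd (Fin s) (Fin n)))).domDomCongr ((blockEquiv hr).trans σ)

theorem basicForm_apply (b : Basis (Fin n) ℂ V) (hr : r = 2 * m + n * s)
    (σ : Equiv.Perm (Fin r)) (δ : Fin m → Fin 2) (v : Fin r → V) :
    basicForm h b hr σ δ v = basicInvariant h b hr σ δ v := by
  rw [basicInvariant_eq]
  rfl

theorem basicInvariant_map (b : Basis (Fin n) ℂ V) (hr : r = 2 * m + n * s)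
    (σ : Equiv.Perm (Fin r)) (δ : Fin m → Fin 2) {g : V ≃ₗ[ℂ] V}
    (hg : g ∈ specialUnitaryGroup h) (v : Fin r → V) :
    basicInvariant h b hr σ δ (fun i => g (v i)) = basicInvariant h b hr σ δ v := by
  obtain ⟨hU, hd⟩ := mem_specialUnitaryGroup_iff.1 hg
  simp only [basicInvariant]
  congr 1
  · refine Finset.prod_congr rfl fun j _ => ?_
    rw [pairing, pairing, ← map_smul, hU]
  · refine Finset.prod_congr rfl fun l _ => ?_
    refine (b.det_comp (g : V →ₗ[ℂ] V) _).trans ?_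
    rw [hd, one_mul]

theorem isInvariantForm_of_mem_span (b : Basis (Fin n) ℂ V) {F : (Fin r → V) → ℝ}
    (hF : F ∈ Submodule.span ℝ (basicRealForms h b r)) : IsInvariantForm h F := by
  induction hF using Submodule.span_induction with
  | mem F hF =>
    obtain ⟨m, s, hr, σ, δ, rfl | rfl⟩ := hF
    · exact ⟨⟨Complex.reLm.compMultilinearMap (basicForm h b hr σ δ), fun v => by
        simp [basicForm_apply]⟩, fun g hg v => by simp only [basicInvariant_map b hr σ δ hg]⟩
    · exact ⟨⟨Complex.imLm.compMultilinearMap (basicForm h b hr σ δ), fun v => by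
        simp [basicForm_apply]⟩, fun g hg v => by simp only [basicInvariant_map b hr σ δ hg]⟩
  | zero => exact ⟨⟨0, fun _ => rfl⟩, fun _ _ _ => rfl⟩
  | add F F' _ _ hF hF' =>
    obtain ⟨⟨f, hf⟩, hg⟩ := hF
    obtain ⟨⟨f', hf'⟩, hg'⟩ := hF'
    exact ⟨⟨f + f', fun v => by simp [hf, hf']⟩, fun g hgm v => by simp [hg g hgm, hg' g hgm]⟩
  | smul c F _ hF =>
    obtain ⟨⟨f, hf⟩, hg⟩ := hF
    exact ⟨⟨c • f, fun v => by simp [hf]⟩, fun g hgm v => by simp [hg g hgm]⟩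

/-- The complex-valued functions all of whose complex multiples have their real part in the real
span of `basicRealForms`. -/
def complexSpan (h : V →ₗ[ℂ] V →ₗ⋆[ℂ] ℂ) (b : Basis (Fin n) ℂ V) (r : ℕ) :
    Submodule ℂ ((Fin r → V) → ℂ) where
  carrier := {φ | ∀ c : ℂ, (fun v => (c * φ v).re) ∈ Submodule.span ℝ (basicRealForms h b r)}
  add_mem' := by
    intro φ ψ hφ hψ c
    have := Submodule.add_mem _ (hφ c) (hψ c)
    simpa [mul_add, Pi.add_def] using this
  zero_mem' := by
    intro c
    simp only [Pi.zero_apply, mul_zero, Complex.zero_re]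
    exact Submodule.zero_mem _
  smul_mem' := by
    intro a φ hφ c
    have := hφ (c * a)
    simpa only [Pi.smul_apply, smul_eq_mul, mul_assoc] using this

theorem conj_mem_complexSpan (b : Basis (Fin n) ℂ V) {φ : (Fin r → V) → ℂ}
    (hφ : φ ∈ complexSpan h b r) : (fun v => (starRingEnd ℂ) (φ v)) ∈ complexSpan h b r := by
  intro c
  have := hφ ((starRingEnd ℂ) c)
  convert this using 2 with v
  simp

theorem basicInvariant_mem_complexSpan (b : Basis (Fin n) ℂ V) (hr : r = 2 * m + n * s)
    (σ : Equiv.Perm (Fin r)) (δ : Fin m → Fin 2) :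
    basicInvariant h b hr σ δ ∈ complexSpan h b r := by
  intro c
  have h1 : (fun v => (c * basicInvariant h b hr σ δ v).re) =
      c.re • (fun v => (basicInvariant h b hr σ δ v).re) -
        c.im • (fun v => (basicInvariant h b hr σ δ v).im) := by
    ext v
    simp
  rw [h1]
  exact Submodule.sub_mem _
    (Submodule.smul_mem _ _ (Submodule.subset_span ⟨m, s, hr, σ, δ, Or.inl rfl⟩))
    (Submodule.smul_mem _ _ (Submodule.subset_span ⟨m, s, hr, σ, δ, Or.inr rfl⟩))

theorem apply_eq_sum_pairing (v w : V) :
    h v w = ∑ δ : Fin 2, Complex.I ^ (δ : ℕ) * (pairing h v (Complex.I ^ (δ : ℕ) • w) : ℂ) := by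
  simp only [Fin.sum_univ_two, Fin.val_zero, Fin.val_one, pow_zero, pow_one, one_mul,
    pairing, map_smulₛₗ, smul_eq_mul, Complex.conj_I]
  apply Complex.ext <;> simp

/-- Expanding every `h(v, w)` as `⟨v, w⟩ + i⟨v, Jw⟩` turns a product of values of `h` and of
determinants into a combination of the maps `basicInvariant`. -/
theorem prod_hermitian_mul_prod_det_mem_complexSpan (b : Basis (Fin n) ℂ V)
    (ρ : (Fin m × Fin 2) ⊕ (Fin s × Fin n) ≃ Fin r) :
    (fun v : Fin r → V => (∏ j, h (v (ρ (Sum.inl (j, 0)))) (v (ρ (Sum.inl (j, 1))))) *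
      ∏ l, b.det fun k => v (ρ (Sum.inr (l, k)))) ∈ complexSpan h b r := by
  have hr : r = 2 * m + n * s := by
    have := Fintype.card_congr ρ
    simp only [Fintype.card_sum, Fintype.card_prod, Fintype.card_fin] at this
    rw [← this, mul_comm m, mul_comm s]
  have key : (fun v : Fin r → V => (∏ j, h (v (ρ (Sum.inl (j, 0)))) (v (ρ (Sum.inl (j, 1))))) *
      ∏ l, b.det fun k => v (ρ (Sum.inr (l, k)))) =
      ∑ δ : Fin m → Fin 2, (∏ j, Complex.I ^ (δ j : ℕ)) •
        basicInvariant h b hr ((blockEquiv hr).symm.trans ρ) δ := by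
    ext v
    simp only [Finset.sum_apply, Pi.smul_apply, smul_eq_mul, basicInvariant_eq,
      Equiv.trans_apply, Equiv.symm_apply_apply]
    simp only [apply_eq_sum_pairing (h := h), Finset.prod_univ_sum, Fintype.piFinset_univ,
      Finset.sum_mul, Finset.prod_mul_distrib, mul_assoc]
  rw [key]
  exact Submodule.sum_mem _ fun δ _ => Submodule.smul_mem _ _
    (basicInvariant_mem_complexSpan b hr _ δ)

end Basic

/-! ### Splitting real multilinear maps into linear and conjugate-linear parts -/

section Types

variable {V : Type*} [AddCommGroup V] [Module ℂ V] {n t r : ℕ} {h : V →ₗ[ℂ] V →ₗ⋆[ℂ] ℂ}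
  {α ι κ : Type*}

/-- Multiplication of the argument number `i` of a real multilinear map by the imaginary unit. -/
noncomputable def rotateArg [DecidableEq α] (i : α) (F : MultilinearMap ℝ (fun _ : α => V) ℂ) :
    MultilinearMap ℝ (fun _ : α => V) ℂ :=
  F.compLinearMap fun j =>
    if j = i then (LinearMap.lsmul ℂ V Complex.I).restrictScalars ℝ else LinearMap.id

theorem rotateArg_apply [DecidableEq α] (i : α) (F : MultilinearMap ℝ (fun _ : α => V) ℂ)
    (v : α → V) : rotateArg i F v = F (Function.update v i (Complex.I • v i)) := by
  rw [rotateArg, MultilinearMap.compLinearMap_apply]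
  congr 1
  ext j
  by_cases hj : j = i
  · subst hj; simp
  · simp [hj]

theorem rotateArg_add [DecidableEq α] (i : α) (F F' : MultilinearMap ℝ (fun _ : α => V) ℂ) :
    rotateArg i (F + F') = rotateArg i F + rotateArg i F' := by
  ext v; simp [rotateArg_apply]

theorem rotateArg_smul [DecidableEq α] (i : α) (c : ℂ) (F : MultilinearMap ℝ (fun _ : α => V) ℂ) :
    rotateArg i (c • F) = c • rotateArg i F := by
  ext v; simp [rotateArg_apply]

theorem rotateArg_rotateArg [DecidableEq α] (i : α) (F : MultilinearMap ℝ (fun _ : α => V) ℂ) :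
    rotateArg i (rotateArg i F) = -F := by
  ext v
  rw [rotateArg_apply, rotateArg_apply]
  simp [smul_smul]

theorem rotateArg_comm [DecidableEq α] (i j : α) (F : MultilinearMap ℝ (fun _ : α => V) ℂ) :
    rotateArg i (rotateArg j F) = rotateArg j (rotateArg i F) := by
  by_cases hij : i = j
  · rw [hij]
  · ext v
    simp only [rotateArg_apply, Function.update_of_ne (Ne.symm hij), Function.update_of_ne hij]
    rw [Function.update_comm hij]

/-- For `a = i` or `a = -i`: the map `F` is complex linear, respectively conjugate-linear, in the
argument number `i` if `rotateArg i F = a • F`. -/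
theorem map_update_smul_complex [DecidableEq α] {i : α} {F : MultilinearMap ℝ (fun _ : α => V) ℂ}
    {a : ℂ} (hF : rotateArg i F = a • F) (v : α → V) (c : ℂ) (x : V) :
    F (Function.update v i (c • x)) = (c.re + c.im * a) * F (Function.update v i x) := by
  have h1 : c • x = c.re • x + c.im • (Complex.I • x) := by
    rw [← Complex.coe_smul, ← Complex.coe_smul, smul_smul, ← add_smul, Complex.re_add_im]
  have h2 : F (Function.update v i (Complex.I • x)) = a * F (Function.update v i x) := by
    have := congrArg (fun H => H (Function.update v i x)) hF
    simpa [rotateArg_apply] using this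
  rw [h1, F.map_update_add, F.map_update_smul, F.map_update_smul, h2, Complex.real_smul,
    Complex.real_smul]
  ring

/-- A real multilinear map which is linear in the arguments indexed by `ι` and conjugate-linear in
those indexed by `κ`, as a function of vectors and covectors, via `w ↦ h(·, w)`. -/
noncomputable def toMixedForm [instι : DecidableEq ι] [instκ : DecidableEq κ]
    (θ : V ≃ₛₗ[starRingEnd ℂ] Dual ℂ V)
    (F : MultilinearMap ℝ (fun _ : ι ⊕ κ => V) ℂ)
    (hι : ∀ i, rotateArg (Sum.inl i) F = Complex.I • F)
    (hκ : ∀ j, rotateArg (Sum.inr j) F = (-Complex.I) • F) : MixedForm ι κ V where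
  toFun v :=
    { toFun := fun ξ => F (Sum.elim v (θ.symm ∘ ξ))
      map_update_add' := by
        intro inst ξ j x y
        obtain rfl : inst = instκ := Subsingleton.elim _ _
        simp only [Function.comp_update, Sum.elim_update_right, map_add, F.map_update_add]
      map_update_smul' := by
        intro inst ξ j c x
        obtain rfl : inst = instκ := Subsingleton.elim _ _
        simp only [Function.comp_update, Sum.elim_update_right, map_smulₛₗ]
        rw [map_update_smul_complex (hκ j)]
        refine congrArg (fun z : ℂ => z * _) ?_
        apply Complex.ext <;> simp }
  map_update_add' := by
    intro inst v i x y
    obtain rfl : inst = instι := Subsingleton.elim _ _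
    ext ξ
    exact (congrArg F (Sum.elim_update_left _ _ _ _)).trans ((F.map_update_add _ _ _ _).trans
      (congrArg₂ (· + ·) (congrArg F (Sum.elim_update_left _ _ _ _).symm)
        (congrArg F (Sum.elim_update_left _ _ _ _).symm)))
  map_update_smul' := by
    intro inst v i c x
    obtain rfl : inst = instι := Subsingleton.elim _ _
    ext ξ
    change F (Sum.elim (Function.update v i (c • x)) (θ.symm ∘ ξ)) =
      c * F (Sum.elim (Function.update v i x) (θ.symm ∘ ξ))
    rw [Sum.elim_update_left, Sum.elim_update_left, map_update_smul_complex (hι i),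
      Complex.re_add_im]

theorem toMixedForm_apply [DecidableEq ι] [DecidableEq κ] (θ : V ≃ₛₗ[starRingEnd ℂ] Dual ℂ V)
    (F : MultilinearMap ℝ (fun _ : ι ⊕ κ => V) ℂ)
    (hι : ∀ i, rotateArg (Sum.inl i) F = Complex.I • F)
    (hκ : ∀ j, rotateArg (Sum.inr j) F = (-Complex.I) • F) (v : ι → V) (ξ : κ → Dual ℂ V) :
    toMixedForm θ F hι hκ v ξ = F (Sum.elim v (θ.symm ∘ ξ)) := rfl

/-- `F` is invariant under the special unitary group. -/
def IsSUInvariant (h : V →ₗ[ℂ] V →ₗ⋆[ℂ] ℂ) (F : MultilinearMap ℝ (fun _ : α => V) ℂ) : Prop :=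
  ∀ g ∈ specialUnitaryGroup h, ∀ v, F (fun i => g (v i)) = F v

theorem toMixedForm_invariant [DecidableEq ι] [DecidableEq κ] (b : Basis (Fin n) ℂ V)
    (hherm : IsHermitianForm h) (hnondeg : h.Nondegenerate)
    {F : MultilinearMap ℝ (fun _ : ι ⊕ κ => V) ℂ}
    (hι : ∀ i, rotateArg (Sum.inl i) F = Complex.I • F)
    (hκ : ∀ j, rotateArg (Sum.inr j) F = (-Complex.I) • F) (hF : IsSUInvariant h F)
    {g : V ≃ₗ[ℂ] V} (hg : g ∈ specialUnitaryGroup h) (v : ι → V) (ξ : κ → Dual ℂ V) :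
    toMixedForm (toDualEquiv b hherm hnondeg) F hι hκ (fun i => g (v i)) ξ =
      toMixedForm (toDualEquiv b hherm hnondeg) F hι hκ v
        (fun j => ξ j ∘ₗ (g : V →ₗ[ℂ] V)) := by
  rw [toMixedForm_apply, toMixedForm_apply, ← hF g hg (Sum.elim v _)]
  congr 1
  ext (i | j)
  · rfl
  · simp only [Sum.elim_inr, Function.comp_apply]
    rw [LinearEquiv.symm_apply_eq]
    ext x
    have h1 := (mem_specialUnitaryGroup_iff.1 hg).1 (g.symm x)
      ((toDualEquiv b hherm hnondeg).symm (ξ j ∘ₗ (g : V →ₗ[ℂ] V)))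
    rw [g.apply_symm_apply] at h1
    rw [toDualEquiv_apply, h1, ← toDualEquiv_apply b hherm hnondeg, LinearEquiv.apply_symm_apply]
    simp

end Types

/-! ### The invariants of the special unitary group -/

section Invariants

variable {V : Type*} [AddCommGroup V] [Module ℂ V] {n t r : ℕ} {h : V →ₗ[ℂ] V →ₗ⋆[ℂ] ℂ}
  {ι κ : Type*}

theorem rotateArg_domDomCongr {α β : Type*} [DecidableEq α] [DecidableEq β] (e : α ≃ β) (i : β)
    (F : MultilinearMap ℝ (fun _ : α => V) ℂ) :
    rotateArg i (F.domDomCongr e) = (rotateArg (e.symm i) F).domDomCongr e := by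
  ext v
  simp only [rotateArg_apply, MultilinearMap.domDomCongr_apply]
  have h1 := Function.update_comp_equiv v e i (Complex.I • v i)
  have h2 : v (e (e.symm i)) = v i := congrArg v (e.apply_symm_apply i)
  rw [h2]
  exact congrArg F h1

/-- A nonzero invariant has as many linear as conjugate-linear arguments, modulo `n`. -/
theorem dvd_card_sub_card_of_isSUInvariant [Fintype ι] [Fintype κ] [DecidableEq ι] [DecidableEq κ]
    (b : Basis (Fin n) ℂ V) (hherm : IsHermitianForm h) (hnondeg : h.Nondegenerate)
    {F : MultilinearMap ℝ (fun _ : Fin r => V) ℂ} (hF : IsSUInvariant h F) (hF0 : F ≠ 0)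
    (e : Fin r ≃ ι ⊕ κ) (hι : ∀ i, rotateArg (e.symm (Sum.inl i)) F = Complex.I • F)
    (hκ : ∀ j, rotateArg (e.symm (Sum.inr j)) F = (-Complex.I) • F) :
    (n : ℤ) ∣ (Fintype.card ι : ℤ) - Fintype.card κ := by
  have hι' : ∀ i, rotateArg (Sum.inl i) (F.domDomCongr e) = Complex.I • F.domDomCongr e :=
    fun i => by rw [rotateArg_domDomCongr, hι]; rfl
  have hκ' : ∀ j, rotateArg (Sum.inr j) (F.domDomCongr e) = (-Complex.I) • F.domDomCongr e :=
    fun j => by rw [rotateArg_domDomCongr, hκ]; rfl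
  refine dvd_card_sub_card b (h := h) (G := toMixedForm (toDualEquiv b hherm hnondeg) _ hι' hκ') ?_
    fun g hg v ξ => toMixedForm_invariant b hherm hnondeg hι' hκ' (fun g hg v => hF g hg _) hg v ξ
  intro h0
  refine hF0 ?_
  ext v
  have h1 : toMixedForm (toDualEquiv b hherm hnondeg) _ hι' hκ' (fun i => v (e.symm (Sum.inl i)))
      (fun j => toDualEquiv b hherm hnondeg (v (e.symm (Sum.inr j)))) = 0 := by
    rw [h0]; rfl
  rw [toMixedForm_apply, MultilinearMap.domDomCongr_apply] at h1
  rw [zero_apply, ← h1]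
  congr 1
  ext i
  obtain ⟨x, rfl⟩ := e.symm.surjective i
  rcases x with x | x <;> simp

/-- The case of at least as many linear as conjugate-linear arguments, which are numbered so that
they match the products of pairings and determinants. -/
theorem mem_complexSpan_of_equiv {m : ℕ} (b : Basis (Fin n) ℂ V) (hherm : IsHermitianForm h)
    (hnondeg : h.Nondegenerate) {F : MultilinearMap ℝ (fun _ : Fin r => V) ℂ}
    (hF : IsSUInvariant h F) (e : Fin r ≃ (Fin m ⊕ Fin t × Fin n) ⊕ Fin m)
    (hι : ∀ i, rotateArg (e.symm (Sum.inl i)) F = Complex.I • F)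
    (hκ : ∀ j, rotateArg (e.symm (Sum.inr j)) F = (-Complex.I) • F) :
    (F : (Fin r → V) → ℂ) ∈ complexSpan h b r := by
  have hι' : ∀ i, rotateArg (Sum.inl i) (F.domDomCongr e) = Complex.I • F.domDomCongr e :=
    fun i => by rw [rotateArg_domDomCongr, hι]; rfl
  have hκ' : ∀ j, rotateArg (Sum.inr j) (F.domDomCongr e) = (-Complex.I) • F.domDomCongr e :=
    fun j => by rw [rotateArg_domDomCongr, hκ]; rfl
  have hmem := mem_span_contraction_of_specialUnitaryGroup b hherm hnondeg
    (G := toMixedForm (toDualEquiv b hherm hnondeg) _ hι' hκ')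
    fun g hg v ξ => toMixedForm_invariant b hherm hnondeg hι' hκ' (fun g hg v => hF g hg _) hg v ξ
  have key : ∀ f ∈ Submodule.span ℂ (Set.range (contraction (κ := Fin m) (t := t) b)),
      (fun v : Fin r → V => f (fun i => v (e.symm (Sum.inl i)))
        (fun j => toDualEquiv b hherm hnondeg (v (e.symm (Sum.inr j))))) ∈
          complexSpan h b r := by
    intro f hf
    induction hf using Submodule.span_induction with
    | mem f hf =>
      obtain ⟨σ, rfl⟩ := hf
      -- The `j`-th pairing takes the linear argument `inl j` and the conjugate-linear argument `j`.
      let τ : (Fin m × Fin 2) ⊕ (Fin t × Fin n) ≃ (Fin m ⊕ Fin t × Fin n) ⊕ Fin m :=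
        { toFun := Sum.elim (fun x => if x.2 = 0 then Sum.inl (Sum.inl x.1) else Sum.inr x.1)
            (fun y => Sum.inl (Sum.inr y))
          invFun := Sum.elim (Sum.elim (fun j => Sum.inl (j, 0)) Sum.inr)
            (fun j => Sum.inl (j, 1))
          left_inv := by
            rintro (⟨j, k⟩ | y)
            · fin_cases k <;> simp
            · simp
          right_inv := by
            rintro ((j | y) | j) <;> simp }
      exact prod_hermitian_mul_prod_det_mem_complexSpan b
        ((τ.trans (Equiv.sumCongr σ (Equiv.refl _))).trans e.symm)
    | zero => exact Submodule.zero_mem _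
    | add f f' _ _ hf hf' => exact Submodule.add_mem _ hf hf'
    | smul c f _ hf => exact Submodule.smul_mem _ c hf
  convert key _ hmem using 1
  ext v
  rw [toMixedForm_apply, MultilinearMap.domDomCongr_apply]
  congr 1
  ext i
  obtain ⟨x, rfl⟩ := e.symm.surjective i
  rcases x with x | x <;> simp

theorem mem_complexSpan_of_card_le (b : Basis (Fin n) ℂ V) (hherm : IsHermitianForm h)
    (hnondeg : h.Nondegenerate) {F : MultilinearMap ℝ (fun _ : Fin r => V) ℂ}
    (hF : IsSUInvariant h F) (p : Fin r → Prop) [DecidablePred p]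
    (hcard : Fintype.card {i // ¬ p i} ≤ Fintype.card {i // p i})
    (hp : ∀ i, p i → rotateArg i F = Complex.I • F)
    (hp' : ∀ i, ¬ p i → rotateArg i F = (-Complex.I) • F) :
    (F : (Fin r → V) → ℂ) ∈ complexSpan h b r := by
  by_cases hF0 : F = 0
  · subst hF0
    exact Submodule.zero_mem _
  obtain ⟨t, ht⟩ := dvd_card_sub_card_of_isSUInvariant b hherm hnondeg hF hF0
    (Equiv.sumCompl p).symm (fun i => hp _ i.2) (fun j => hp' _ j.2)
  obtain ⟨t, ht⟩ : ∃ t : ℕ, Fintype.card {i // p i} = Fintype.card {i // ¬ p i} + t * n := by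
    have : n ∣ Fintype.card {i // p i} - Fintype.card {i // ¬ p i} := by
      rw [← Int.natCast_dvd_natCast, Nat.cast_sub hcard]
      exact ⟨t, ht⟩
    obtain ⟨t, ht⟩ := this
    exact ⟨t, by rw [mul_comm, ← ht]; omega⟩
  let e₁ : {i // p i} ≃ Fin (Fintype.card {i // ¬ p i}) ⊕ Fin t × Fin n :=
    Fintype.equivOfCardEq (by rw [ht]; simp)
  let e₂ : {i // ¬ p i} ≃ Fin (Fintype.card {i // ¬ p i}) := Fintype.equivFin _
  exact mem_complexSpan_of_equiv b hherm hnondeg hF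
    ((Equiv.sumCompl p).symm.trans (Equiv.sumCongr e₁ e₂))
    (fun i => hp _ (e₁.symm i).2) (fun j => hp' _ (e₂.symm j).2)

/-- The complex conjugate of a real multilinear map. -/
noncomputable def conjForm {α : Type*} (F : MultilinearMap ℝ (fun _ : α => V) ℂ) :
    MultilinearMap ℝ (fun _ : α => V) ℂ :=
  Complex.conjAe.toLinearMap.compMultilinearMap F

theorem conjForm_apply {α : Type*} (F : MultilinearMap ℝ (fun _ : α => V) ℂ) (v : α → V) :
    conjForm F v = (starRingEnd ℂ) (F v) := rfl

theorem rotateArg_conjForm {α : Type*} [DecidableEq α] {i : α}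
    {F : MultilinearMap ℝ (fun _ : α => V) ℂ} {a : ℂ} (hF : rotateArg i F = a • F) :
    rotateArg i (conjForm F) = (starRingEnd ℂ) a • conjForm F := by
  ext v
  have := congrArg (fun H => H v) hF
  simp only [rotateArg_apply, smul_apply, conjForm_apply, smul_eq_mul] at this ⊢
  rw [this, map_mul]

/-- The case of an invariant which is linear or conjugate-linear in each argument. Complex
conjugation reduces it to the case of at least as many linear as conjugate-linear arguments. -/
theorem mem_complexSpan_of_typed (b : Basis (Fin n) ℂ V) (hherm : IsHermitianForm h)
    (hnondeg : h.Nondegenerate) {F : MultilinearMap ℝ (fun _ : Fin r => V) ℂ}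
    (hF : IsSUInvariant h F)
    (hp : ∀ i, rotateArg i F = Complex.I • F ∨ rotateArg i F = (-Complex.I) • F) :
    (F : (Fin r → V) → ℂ) ∈ complexSpan h b r := by
  classical
  let p : Fin r → Prop := fun i => rotateArg i F = Complex.I • F
  have hp' : ∀ i, ¬ p i → rotateArg i F = (-Complex.I) • F := fun i hi => (hp i).resolve_left hi
  rcases le_total (Fintype.card {i // ¬ p i}) (Fintype.card {i // p i}) with hle | hle
  · exact mem_complexSpan_of_card_le b hherm hnondeg hF p hle (fun i hi => hi) hp'
  · have h1 : IsSUInvariant h (conjForm F) := fun g hg v => by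
      rw [conjForm_apply, conjForm_apply, hF g hg]
    have h2 := mem_complexSpan_of_card_le b hherm hnondeg h1 (fun i => ¬ p i)
      (by simpa only [not_not] using hle)
      (fun i hi => by simpa using rotateArg_conjForm (hp' i hi))
      (fun i hi => by simpa using rotateArg_conjForm (not_not.1 hi))
    simpa [conjForm_apply] using conj_mem_complexSpan b h2

/-- Every invariant is the sum of invariants which are linear or conjugate-linear in each
argument; they are split off one argument at a time. -/
theorem mem_complexSpan_of_isSUInvariant (b : Basis (Fin n) ℂ V) (hherm : IsHermitianForm h)
    (hnondeg : h.Nondegenerate) {F : MultilinearMap ℝ (fun _ : Fin r => V) ℂ}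
    (hF : IsSUInvariant h F) : (F : (Fin r → V) → ℂ) ∈ complexSpan h b r := by
  suffices H : ∀ (S : Finset (Fin r)) (F : MultilinearMap ℝ (fun _ : Fin r => V) ℂ),
      IsSUInvariant h F →
      (∀ i ∉ S, rotateArg i F = Complex.I • F ∨ rotateArg i F = (-Complex.I) • F) →
      (F : (Fin r → V) → ℂ) ∈ complexSpan h b r from
    H Finset.univ F hF fun i hi => absurd (Finset.mem_univ i) hi
  intro S
  induction S using Finset.induction with
  | empty => exact fun F hF hp => mem_complexSpan_of_typed b hherm hnondeg hF fun i => hp i (by simp)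
  | insert i S _ ih =>
    intro F hF hp
    -- `F` is half the sum of `F - i F(…, J vᵢ, …)`, which is complex linear in the argument
    -- number `i`, and of `F + i F(…, J vᵢ, …)`, which is conjugate-linear in it.
    have hpart : ∀ a : ℂ, a = Complex.I ∨ a = -Complex.I →
        ((((1 / 2 : ℂ) • (F + (-a) • rotateArg i F) :
          MultilinearMap ℝ (fun _ : Fin r => V) ℂ)) : (Fin r → V) → ℂ) ∈ complexSpan h b r := by
      intro a ha
      have ha2 : a * a = -1 := by rcases ha with rfl | rfl <;> simp
      refine ih _ ?_ ?_
      · intro g hg v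
        have h1 : rotateArg i F (fun j => g (v j)) = rotateArg i F v := by
          rw [rotateArg_apply, rotateArg_apply, ← hF g hg (Function.update v i _)]
          congr 1
          ext j
          by_cases hj : j = i
          · subst hj; simp
          · simp [hj]
        simp only [smul_apply, add_apply, h1, hF g hg]
      · intro j hj
        by_cases hji : j = i
        · subst hji
          have h1 : rotateArg j ((1 / 2 : ℂ) • (F + (-a) • rotateArg j F)) =
              a • ((1 / 2 : ℂ) • (F + (-a) • rotateArg j F)) := by
            rw [rotateArg_smul, rotateArg_add, rotateArg_smul, rotateArg_rotateArg]
            ext v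
            simp only [smul_apply, add_apply, neg_apply, smul_eq_mul]
            linear_combination (1 / 2 * rotateArg j F v) * ha2
          rcases ha with rfl | rfl
          · exact Or.inl h1
          · exact Or.inr h1
        · have hjS : j ∉ insert i S := by simp [hji, hj]
          refine (hp j hjS).imp ?_ ?_ <;>
          · intro h1
            rw [rotateArg_smul, rotateArg_add, rotateArg_smul, rotateArg_comm, h1, rotateArg_smul]
            module
    have h1 := Submodule.add_mem _ (hpart Complex.I (Or.inl rfl)) (hpart (-Complex.I) (Or.inr rfl))
    convert h1 using 1
    ext v
    simp only [Pi.add_apply, smul_apply, add_apply, smul_eq_mul]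
    ring

end Invariants

end UnitaryInvariants

theorem proposition2p8 {V : Type*} [AddCommGroup V] [Module ℂ V] (n : ℕ)
    (b : Module.Basis (Fin n) ℂ V) (h : V →ₗ[ℂ] V →ₗ⋆[ℂ] ℂ)
    (hherm : UnitaryInvariants.IsHermitianForm h) (hnondeg : h.Nondegenerate) (r : ℕ) :
    {F : (Fin r → V) → ℝ | UnitaryInvariants.IsInvariantForm h F} =
      (Submodule.span ℝ (UnitaryInvariants.basicRealForms h b r) : Set ((Fin r → V) → ℝ)) := by
  ext F
  refine ⟨?_, fun hF => UnitaryInvariants.isInvariantForm_of_mem_span b hF⟩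
  rintro ⟨⟨f, hf⟩, hinv⟩
  have h1 := UnitaryInvariants.mem_complexSpan_of_isSUInvariant b hherm hnondeg
    (F := Complex.ofRealAm.toLinearMap.compMultilinearMap f) (fun g hg v => by
      simp [hf, hinv g hg]) 1
  have h2 : F = fun v => (1 * (Complex.ofRealAm.toLinearMap.compMultilinearMap f) v).re := by
    ext v
    simp [hf]
  rw [h2]
  exact h1
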